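/- Let $L>0$, $\mu\in\mathbb R$ and let $m\ge 1$ be an integer. For $f\in L^2(0,L)$ (complex-valued) write $f_n=\langle f,e_n\rangle=\int_0^L f\,\overline{e_n}$ with $e_n(x)=L^{-1/2}e^{2i\pi nx/L}$, $n\in\mathbb Z$, and for an integer $s\ge 0$ let $H^s_{per}$ be the space of $f\in L^2(0,L)$ with $\|f\|_s^2:=\sum_n\big(1+|2i\pi n/L|^{2s}\big)|f_n|^2<\infty$. Let $H^m_{(pw)}$ be the space of functions on $(0,L)$ for which there are finitely many points $0=\sigma_0\le\sigma_1\le\dots\le\sigma_{d+1}=L$ such that the function is in $H^m(\sigma_j,\sigma_{j+1})$ for every $j$. Let $\varphi\in H^m_{(pw)}\cap H^{m-1}_{per}$ satisfy $$\frac{c}{\sqrt{1+|2i\pi n/L|^{2m}}}\le|\varphi_n|\le\frac{C}{\sqrt{1+|2i\pi n/L|^{2m}}}\qquad\text{for all } n\in\mathbb Z,$$ where $c,C>0$ are the optimal constants in these inequalities. Let $\lambda>0$ and define the feedback law $$F_n=-\frac{K(\lambda)}{\overline{\varphi_n}},\qquad K(\lambda)=\frac2L\,\frac{1-e^{-\lambda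 L}}{1+e^{-\lambda L}},\qquad \langle\alpha,F\rangle=\lim_{N\to\infty}\sum_{|n|\le N}\overline{F_n}\,\alpha_n .$$ Consider in $H^m_{per}$ the closed-loop system $$\alpha_t+\alpha_x+\mu\alpha=\langle\alpha(t),F\rangle\varphi,\qquad \alpha(t,0)=\alpha(t,L),$$ that is, $\alpha'=\mathcal A\alpha$ with $\mathcal A\alpha=-\alpha_x-\mu\alpha+\langle\alpha,F\rangle\varphi$ ($\alpha_x$ being the derivative of the $L$-periodic distribution $\alpha$), on the domain of those $\alpha\in H^m_{per}$ for which $\langle\alpha,F\rangle$ exists and $\mathcal A\alpha\in H^m_{per}$. Then $\mathcal A$ is the infinitesimal generator of a $C_0$-semigroup $(S(t))_{t\ge0}$ on $H^m_{per}$, and $S(t)=T^{-1}R(t)T$, where $R(t)\alpha=e^{-(\lambda+\mu)t}\alpha(\cdot-t)$ ($\alpha$ being continued $L$-periodically) is the $C_0$-semigroup of the target system $z_t+z_x+(\lambda+\mu)z=0$, $z(t,0)=z(t,L)$, and $T$ is the isomorphism of $H^m_{per}$ onto itself given by $$(T\alpha)_p=-\varphi_p\sum_{n\in\mathbb Z}\frac{\overline{F_n}\,\alpha_n}{\lambda+2i\pi(p-n)/L},\qquad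 p\in\mathbb Z .$$ For every $\alpha_0\in H^m_{per}$, $\alpha(t)=S(t)\alpha_0$ is a (mild) solution of the closed-loop system with $\alpha(0)=\alpha_0$: it is continuous from $[0,\infty)$ to $H^m_{per}$, and for every $t\ge 0$ the integral $\int_0^t\alpha(s)\,ds$ lies in the domain of $\mathcal A$ and $\alpha(t)=\alpha_0+\mathcal A\int_0^t\alpha(s)\,ds$. It satisfies $$\|\alpha(t)\|_m\le\Big(\frac Cc\Big)^2e^{\lambda L}e^{-(\lambda+\mu)t}\|\alpha_0\|_m\qquad\text{for all } t\ge0;$$ in particular, if $\mu\ge0$, $$\|\alpha(t)\|_m\le\Big(\frac Cc\Big)^2e^{(\mu+\lambda)L}e^{-\lambda t}\|\alpha_0\|_m\qquad\text{for all } t\ge0 .$$ -/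

import Mathlib

open MeasureTheory Filter Topology
open scoped ContDiff ComplexConjugate ENNReal

noncomputable section

namespace TransportStab

/-! ### Fourier coefficients on `(0, L)` -/

/-- The Hilbert space `L²(0, L)` of complex-valued functions, with Lebesgue measure. -/
abbrev L2 (L : ℝ) : Type := Lp ℂ 2 (volume.restrict (Set.Ioc 0 L))

/-- The Hilbert basis `e_n(x) = L^{-1/2} exp(2 i π n x / L)`. -/
def eBasis (L : ℝ) (n : ℤ) (x : ℝ) : ℂ :=
  (1 / Real.sqrt L : ℝ) * Complex.exp (2 * Real.pi * Complex.I * n * x / L)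

/-- The Fourier coefficient `f_n = ⟨f, e_n⟩ = ∫_0^L f(x) conj(e_n(x)) dx`. -/
def coef {L : ℝ} (f : L2 L) (n : ℤ) : ℂ :=
  ∫ x in Set.Ioc 0 L, f x * conj (eBasis L n x)

/-- The frequency `2 i π n / L`. -/
def freq (L : ℝ) (n : ℤ) : ℂ := 2 * Real.pi * Complex.I * n / L

/-- The Sobolev weight `1 + |2 i π n / L|^{2s}`. -/
def weight (L : ℝ) (s : ℕ) (n : ℤ) : ℝ := 1 + ‖freq L n‖ ^ (2 * s)

theorem eBasis_integrable {L : ℝ} (f : L2 L) (n : ℤ) :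
    Integrable (fun x => f x * conj (eBasis L n x)) (volume.restrict (Set.Ioc 0 L)) := by
  have hf : Integrable (fun x => f x) (volume.restrict (Set.Ioc 0 L)) :=
    (Lp.memLp f).integrable (by norm_num)
  refine hf.mul_bdd (c := |1 / Real.sqrt L|) ?_ (Eventually.of_forall fun x => ?_)
  · apply Continuous.aestronglyMeasurable
    unfold eBasis
    fun_prop
  · have h : 2 * (Real.pi : ℂ) * Complex.I * n * x / L
        = ((2 * Real.pi * n * x / L : ℝ) : ℂ) * Complex.I := by
      push_cast
      ring
    rw [RCLike.norm_conj, eBasis, h, norm_mul, Complex.norm_exp_ofReal_mul_I, mul_one,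
      Complex.norm_real, Real.norm_eq_abs]

theorem coef_add {L : ℝ} (f g : L2 L) (n : ℤ) : coef (f + g) n = coef f n + coef g n := by
  unfold coef
  rw [← integral_add (eBasis_integrable f n) (eBasis_integrable g n)]
  refine integral_congr_ae ?_
  filter_upwards [Lp.coeFn_add f g] with x hx
  rw [hx, Pi.add_apply, add_mul]

theorem coef_smul {L : ℝ} (a : ℂ) (f : L2 L) (n : ℤ) : coef (a • f) n = a * coef f n := by
  unfold coef
  rw [← integral_const_mul]
  refine integral_congr_ae ?_
  filter_upwards [Lp.coeFn_smul a f] with x hx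
  rw [hx, Pi.smul_apply, smul_eq_mul, mul_assoc]

theorem coef_zero {L : ℝ} (n : ℤ) : coef (0 : L2 L) n = 0 := by
  have h := coef_smul (L := L) 0 0 n
  simpa using h

/-- A function of `L²(0, L)` is determined by its Fourier coefficients. -/
theorem eq_zero_of_coef {L : ℝ} (f : L2 L) (h : ∀ n, coef f n = 0) : f = 0 := by
  rcases le_or_gt L 0 with hL | hL
  · have h0 : volume.restrict (Set.Ioc 0 L) = 0 := by
      rw [Set.Ioc_eq_empty (not_lt.mpr hL), Measure.restrict_empty]
    apply Lp.ext
    have hb : ae (volume.restrict (Set.Ioc 0 L)) = ⊥ := ae_eq_bot.mpr h0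
    rw [Filter.EventuallyEq, hb]
    exact Filter.eventually_bot
  · have hz : ∀ n, fourierCoeffOn hL (f : ℝ → ℂ) n = 0 := by
      intro n
      rw [fourierCoeffOn_eq_integral, intervalIntegral.integral_of_le hL.le]
      have h1 := h n
      unfold coef at h1
      have h2 : ∀ x : ℝ, f x * conj (eBasis L n x) =
          ((1 / Real.sqrt L : ℝ) : ℂ) *
            ((fourier (-n) (x : AddCircle (L - 0)) : ℂ) • f x) := by
        intro x
        rw [fourier_coe_apply, eBasis, map_mul, Complex.conj_ofReal, ← Complex.exp_conj,
          smul_eq_mul]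
        have h3 : conj (2 * (Real.pi : ℂ) * Complex.I * n * x / L)
            = 2 * Real.pi * Complex.I * ((-n : ℤ) : ℂ) * x / ((L - 0 : ℝ) : ℂ) := by
          simp [Complex.conj_ofReal, Complex.conj_ofNat]
        rw [h3]
        ring
      simp_rw [h2] at h1
      rw [integral_const_mul] at h1
      have h4 : ((1 / Real.sqrt L : ℝ) : ℂ) ≠ 0 := by
        have := Real.sqrt_pos.mpr hL
        exact_mod_cast (by positivity : (1 / Real.sqrt L : ℝ) ≠ 0)
      rw [(mul_eq_zero.mp h1).resolve_left h4, smul_zero]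
    have hs := hasSum_sq_fourierCoeffOn hL (Lp.memLp f)
    simp_rw [hz] at hs
    have h0 : (L - 0)⁻¹ • ∫ x in (0 : ℝ)..L, ‖f x‖ ^ 2 = 0 :=
      hs.unique (by simp)
    have h5 : ∫ x in Set.Ioc 0 L, ‖f x‖ ^ 2 = 0 := by
      rw [← intervalIntegral.integral_of_le hL.le]
      rw [smul_eq_mul] at h0
      exact (mul_eq_zero.mp h0).resolve_left (by rw [sub_zero]; positivity)
    have h6 := (integral_eq_zero_iff_of_nonneg (fun x => by positivity)
      ((Lp.memLp f).integrable_norm_pow (by norm_num))).mp h5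
    apply Lp.ext
    filter_upwards [h6, Lp.coeFn_zero ℂ 2 (volume.restrict (Set.Ioc 0 L))] with x hx hx0
    rw [hx0]
    simpa using hx

/-! ### Periodic Sobolev spaces -/

theorem memlp_iff {L : ℝ} (s : ℕ) (f : L2 L) :
    Memℓp (fun n : ℤ => (Real.sqrt (weight L s n) : ℂ) * coef f n) 2 ↔
      Summable (fun n : ℤ => weight L s n * ‖coef f n‖ ^ 2) := by
  rw [memℓp_gen_iff (by norm_num)]
  have h : ∀ n : ℤ, ‖(Real.sqrt (weight L s n) : ℂ) * coef f n‖ ^ (2 : ℝ≥0∞).toReal =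
      weight L s n * ‖coef f n‖ ^ 2 := ?_
  · simp_rw [h]
  intro n
  have hw : 0 ≤ weight L s n := by unfold weight; positivity
  rw [ENNReal.toReal_ofNat, Real.rpow_ofNat, norm_mul, mul_pow, Complex.norm_real,
    Real.norm_eq_abs, sq_abs, Real.sq_sqrt hw]

/-- The periodic Sobolev space `H^s_per`: the `f ∈ L²(0, L)` with
`∑ (1 + |2iπn/L|^{2s}) |f_n|² < ∞`. -/
def perSobolev (L : ℝ) (s : ℕ) : Submodule ℂ (L2 L) where
  carrier := {f | Summable (fun n : ℤ => weight L s n * ‖coef f n‖ ^ 2)}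
  add_mem' {f g} hf hg := by
    have h := ((memlp_iff s f).mpr hf).add ((memlp_iff s g).mpr hg)
    refine (memlp_iff s (f + g)).mp ?_
    convert h using 2 with n
    rw [coef_add]
    ring_nf
    rfl
  zero_mem' := by simp [coef_zero]
  smul_mem' a f hf := by
    have h := ((memlp_iff s f).mpr hf).const_smul a
    refine (memlp_iff s (a • f)).mp ?_
    convert h using 2 with n
    rw [coef_smul]
    simp only [Pi.smul_apply, smul_eq_mul]
    ring

/-- `H^s_per` as a type of its own; its norm is the Sobolev norm below, not the `L²` norm. -/
def HPer (L : ℝ) (s : ℕ) : Type := ↥(perSobolev L s)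

instance (L : ℝ) (s : ℕ) : AddCommGroup (HPer L s) :=
  inferInstanceAs (AddCommGroup ↥(perSobolev L s))

instance (L : ℝ) (s : ℕ) : Module ℂ (HPer L s) :=
  inferInstanceAs (Module ℂ ↥(perSobolev L s))

/-- The underlying function of `L²(0, L)`. -/
def HPer.toL2 {L : ℝ} {s : ℕ} (f : HPer L s) : L2 L := f.1

/-- The Fourier coefficients of an element of `H^s_per`. -/
def HPer.coef {L : ℝ} {s : ℕ} (f : HPer L s) (n : ℤ) : ℂ := TransportStab.coef f.toL2 n

/-- The map `f ↦ ((1 + |2iπn/L|^{2s})^{1/2} f_n)_n` into `ℓ²(ℤ)`. -/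
def weightedCoef (L : ℝ) (s : ℕ) : HPer L s →ₗ[ℂ] lp (fun _ : ℤ => ℂ) 2 where
  toFun f := ⟨fun n : ℤ => (Real.sqrt (weight L s n) : ℂ) * f.coef n, (memlp_iff s f.1).mpr f.2⟩
  map_add' f g := by
    ext n
    change (Real.sqrt (weight L s n) : ℂ) * TransportStab.coef (f.1 + g.1) n =
      (Real.sqrt (weight L s n) : ℂ) * TransportStab.coef f.1 n +
        (Real.sqrt (weight L s n) : ℂ) * TransportStab.coef g.1 n
    rw [coef_add, mul_add]
  map_smul' a f := by
    ext n
    change (Real.sqrt (weight L s n) : ℂ) * TransportStab.coef (a • f.1) n =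
      a * ((Real.sqrt (weight L s n) : ℂ) * TransportStab.coef f.1 n)
    rw [coef_smul]
    ring

theorem weightedCoef_injective (L : ℝ) (s : ℕ) : Function.Injective (weightedCoef L s) := by
  rw [injective_iff_map_eq_zero]
  intro f hf
  apply Subtype.ext
  refine eq_zero_of_coef f.1 fun n => ?_
  have h : (Real.sqrt (weight L s n) : ℂ) * TransportStab.coef f.1 n = 0 :=
    congrArg (fun g : lp (fun _ : ℤ => ℂ) 2 => g n) hf
  have hw : 0 < weight L s n := by unfold weight; positivity
  refine (mul_eq_zero.mp h).resolve_left ?_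
  exact_mod_cast (Real.sqrt_pos.mpr hw).ne'

/-- The norm `‖f‖_s = (∑ (1 + |2iπn/L|^{2s}) |f_n|²)^{1/2}` on `H^s_per`. -/
instance (L : ℝ) (s : ℕ) : NormedAddCommGroup (HPer L s) :=
  NormedAddCommGroup.induced (HPer L s) (lp (fun _ : ℤ => ℂ) 2) (weightedCoef L s)
    (weightedCoef_injective L s)

instance (L : ℝ) (s : ℕ) : NormedSpace ℂ (HPer L s) :=
  NormedSpace.induced ℂ (HPer L s) (lp (fun _ : ℤ => ℂ) 2) (weightedCoef L s)

theorem HPer.norm_sq_eq {L : ℝ} {s : ℕ} (f : HPer L s) :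
    ‖f‖ ^ 2 = ∑' n : ℤ, weight L s n * ‖f.coef n‖ ^ 2 := by
  have h := lp.norm_rpow_eq_tsum (p := 2) (by norm_num) (weightedCoef L s f)
  rw [ENNReal.toReal_ofNat, Real.rpow_ofNat] at h
  refine h.trans (tsum_congr fun n => ?_)
  have hw : 0 ≤ weight L s n := by unfold weight; positivity
  change ‖(Real.sqrt (weight L s n) : ℂ) * f.coef n‖ ^ (2 : ℝ) = _
  rw [Real.rpow_ofNat, norm_mul, mul_pow, Complex.norm_real, Real.norm_eq_abs, sq_abs,
    Real.sq_sqrt hw]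

/-! ### Piecewise Sobolev functions -/

/-- `g` is the `k`-th weak derivative of `f` on the open interval `(a, b)`. -/
def IsWeakDeriv (a b : ℝ) (k : ℕ) (f g : ℝ → ℂ) : Prop :=
  ∀ ψ : ℝ → ℝ, ContDiff ℝ ∞ ψ → HasCompactSupport ψ → tsupport ψ ⊆ Set.Ioo a b →
    ∫ x in Set.Ioo a b, f x * ((iteratedDeriv k ψ x : ℝ) : ℂ) =
      (-1) ^ k * ∫ x in Set.Ioo a b, g x * (ψ x : ℂ)

/-- The usual Sobolev space `H^m(a, b)`: all weak derivatives of order at most `m` exist and are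
square integrable. -/
def MemSobolev (m : ℕ) (a b : ℝ) (f : ℝ → ℂ) : Prop :=
  MemLp f 2 (volume.restrict (Set.Ioo a b)) ∧
    ∀ k ≤ m, ∃ g : ℝ → ℂ, MemLp g 2 (volume.restrict (Set.Ioo a b)) ∧ IsWeakDeriv a b k f g

/-- The space `H^m_(pw)`: there are finitely many points
`0 = σ_0 ≤ σ_1 ≤ … ≤ σ_d ≤ σ_{d+1} = L` such that `f` is `H^m` between consecutive points. -/
def IsPiecewiseSobolev (m : ℕ) (L : ℝ) (f : ℝ → ℂ) : Prop :=
  ∃ (d : ℕ) (σ : Fin (d + 2) → ℝ), Monotone σ ∧ σ 0 = 0 ∧ σ (Fin.last (d + 1)) = L ∧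
    ∀ j : Fin (d + 1), MemSobolev m (σ j.castSucc) (σ j.succ) f

/-! ### Semigroups and generators -/

section Semigroup

variable {X : Type*} [NormedAddCommGroup X] [NormedSpace ℂ X]

/-- `(S t)_{t ≥ 0}` is a strongly continuous semigroup of bounded operators on `X`
(the values at negative times are irrelevant). -/
structure IsC0Semigroup (S : ℝ → X →L[ℂ] X) : Prop where
  zero : S 0 = ContinuousLinearMap.id ℂ X
  add : ∀ s t : ℝ, 0 ≤ s → 0 ≤ t → S (s + t) = (S s).comp (S t)
  cont : ∀ x : X, ContinuousOn (fun t => S t x) (Set.Ici 0)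

/-- `x` is in the domain of the infinitesimal generator of `S`, with image `y`. -/
def IsGenValue (S : ℝ → X →L[ℂ] X) (x y : X) : Prop :=
  Tendsto (fun h : ℝ => h⁻¹ • (S h x - x)) (𝓝[>] 0) (𝓝 y)

end Semigroup

/-! ### The closed-loop system -/

/-- `K(λ) = (2 / L) (1 - e^{-λL}) / (1 + e^{-λL})`. -/
def gain (L lam : ℝ) : ℝ :=
  2 / L * ((1 - Real.exp (-lam * L)) / (1 + Real.exp (-lam * L)))

/-- The coefficients `F_n = -K(λ) / conj(φ_n)` of the feedback law. -/
def feedback {L : ℝ} (lam : ℝ) (φ : L2 L) (n : ℤ) : ℂ :=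
  -(gain L lam : ℂ) / conj (coef φ n)

/-- `⟨α, F⟩ = ∑_n conj(F_n) α_n` is defined and equal to `u`; the (in general not absolutely
convergent) sum is the limit of the symmetric partial sums, that is of `⟨α^{(N)}, F⟩` with
`α^{(N)} = ∑_{|n| ≤ N} α_n e_n`. -/
def HasPairing {L : ℝ} {m : ℕ} (F : ℤ → ℂ) (α : HPer L m) (u : ℂ) : Prop :=
  Tendsto (fun N : ℕ => ∑ n ∈ Finset.Icc (-(N : ℤ)) N, conj (F n) * α.coef n) atTop (𝓝 u)

/-- The closed-loop operator `A + BK` on `H^m_per`: `α` is in its (maximal) domain, with image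
`g = -α_x - μ α + ⟨α, F⟩ φ ∈ H^m_per`. Here `α_x` is the derivative of the `L`-periodic
distribution `α`, that is `(α_x)_n = (2iπn/L) α_n`. -/
def ClosedLoopOp {L : ℝ} {m : ℕ} (μ : ℝ) (F : ℤ → ℂ) (φ : L2 L) (α g : HPer L m) : Prop :=
  ∃ u : ℂ, HasPairing F α u ∧
    ∀ n : ℤ, g.coef n = -(freq L n * α.coef n) - μ * α.coef n + u * coef φ n

/-- `α : [0, ∞) → H^m_per` is a (mild) solution of the closed-loop system
`α_t + α_x + μ α = ⟨α(t), F⟩ φ`, `α(t, 0) = α(t, L)`, with initial state `α₀`: it is continuous,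
`∫_0^t α` lies in the domain of `A + BK`, and `α(t) = α₀ + (A + BK) ∫_0^t α` for all `t ≥ 0`. -/
structure IsClosedLoopSolution {L : ℝ} {m : ℕ} (μ : ℝ) (F : ℤ → ℂ) (φ : L2 L)
    (α₀ : HPer L m) (α : ℝ → HPer L m) : Prop where
  cont : ContinuousOn α (Set.Ici 0)
  init : α 0 = α₀
  eqn : ∀ t : ℝ, 0 ≤ t → ClosedLoopOp μ F φ (∫ s in (0 : ℝ)..t, α s) (α t - α₀)

/-! ### The target system and the transformation -/

/-- `R` is the semigroup of the target system `z_t + z_x + ν z = 0`, `z(t, 0) = z(t, L)`: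
`(R(t) α)(x) = e^{-νt} α(x - t)`, where `α` is continued `L`-periodically. -/
def IsTransport {L : ℝ} (hL : 0 < L) {m : ℕ} (ν : ℝ) (R : ℝ → HPer L m →L[ℂ] HPer L m) : Prop :=
  ∀ t : ℝ, 0 ≤ t → ∀ α : HPer L m, ∀ᵐ x ∂(volume.restrict (Set.Ioc 0 L)),
    (R t α).toL2 x = (Real.exp (-ν * t) : ℂ) * α.toL2 (toIocMod hL 0 (x - t))

/-- The Fourier coefficients of `k_n = -conj(F_{-n}) Λ_n ⋆ φ`, where
`(Λ_n)_p = 1 / (λ + 2iπ(n+p)/L)`. -/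
def kernelCoef {L : ℝ} (lam : ℝ) (F : ℤ → ℂ) (φ : L2 L) (n p : ℤ) : ℂ :=
  -conj (F (-n)) * (1 / (lam + freq L (n + p))) * coef φ p

/-- `T` is the transformation `T α = ∑_n α_n k_{-n}`. -/
def IsBackstepping {L : ℝ} {m : ℕ} (lam : ℝ) (F : ℤ → ℂ) (φ : L2 L)
    (T : HPer L m ≃L[ℂ] HPer L m) : Prop :=
  ∀ (α : HPer L m) (p : ℤ),
    HasSum (fun n : ℤ => α.coef n * kernelCoef lam F φ (-n) p) ((T α).coef p)

end TransportStab

end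

noncomputable section

namespace TransportStab

/-! ### The Fourier basis as a Hilbert basis -/

/-! Divide by `φ`: the bounds on `φ_n` make `α_n = φ_n f_n` an isomorphism `Φ : α ↦ f` of `H^m_per`
onto `L²(0, L)`. Since `conj F_n = -K / φ_n`, the closed loop becomes `f_t + f_x + μ f = u √L δ_0`
with `u = -K ∑ f_n`, a transport equation forced only at the junction of `0` and `L`. Formally, the
source says `f(0+) - f(L-) = √L u`, and the symmetric sum of the `f_n` is `√L (f(0+) + f(L-)) / 2`.
The value of `K` turns these into `f(0+) = e^{-λL} f(L-)`, which is periodicity of `e^{-λx} f`. So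
multiplication by `e^{-λx}` carries the closed loop to the target system, with damping `λ + μ`.

In these variables `T` is multiplication by `k e^{-λx}`, `k = 2 / (1 + e^{-λL})`, because the matrix
of `e^{-λx}` in the basis `e_n` is `(1 - e^{-λL}) / L` times `1 / (λ + 2iπ(p-n)/L)`
(`coef_expMul_basisFun`). The bounds of `T` and its inverse follow: `Φ` and `Φ⁻¹` contribute `1/c`
and `C` each time, the multiplications `k` and `k⁻¹ e^{λL}`.

The trace argument is done on Fourier coefficients, which also settles the exact domain:
`expMul_coef_eq_iff` matches the two operators, using that the symmetric sum of `1 / (λ +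
2iπ(p-n)/L)` is `1 / K` for every `p` (`tendsto_sum_resolvent_sub`). Everything else is conjugation
of the explicit transport semigroup by `T` (`isGenValue_conjFamily_iff`,
`isGenValue_transport_iff`). -/

theorem freq_add (L : ℝ) (n k : ℤ) : freq L (n + k) = freq L n + freq L k := by
  simp only [freq, Int.cast_add]; ring

theorem freq_neg (L : ℝ) (n : ℤ) : freq L (-n) = -freq L n := by
  simp only [freq, Int.cast_neg]; ring

theorem freq_sub (L : ℝ) (n k : ℤ) : freq L (n - k) = freq L n - freq L k := by
  rw [sub_eq_add_neg, freq_add, freq_neg, sub_eq_add_neg]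

theorem freq_zero (L : ℝ) : freq L 0 = 0 := by simp [freq]

theorem freq_eq (L : ℝ) (n : ℤ) : freq L n = ((2 * Real.pi * n / L : ℝ) : ℂ) * Complex.I := by
  unfold freq
  push_cast
  ring

theorem freq_re (L : ℝ) (n : ℤ) : (freq L n).re = 0 := by
  rw [freq_eq, Complex.re_ofReal_mul, Complex.I_re, mul_zero]

theorem conj_freq (L : ℝ) (n : ℤ) : conj (freq L n) = -freq L n := by
  rw [freq_eq, map_mul, Complex.conj_ofReal, Complex.conj_I, mul_neg]

theorem norm_exp_freq_mul (L : ℝ) (n : ℤ) (x : ℝ) : ‖Complex.exp (freq L n * x)‖ = 1 := by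
  rw [freq_eq, mul_right_comm, ← Complex.ofReal_mul, Complex.norm_exp_ofReal_mul_I]

theorem exp_freq_mul_period {L : ℝ} (hL : 0 < L) (n : ℤ) : Complex.exp (freq L n * L) = 1 := by
  have hL' : (L : ℂ) ≠ 0 := by exact_mod_cast hL.ne'
  rw [Complex.exp_eq_one_iff]
  refine ⟨n, ?_⟩
  unfold freq
  field_simp

theorem ofReal_add_freq_ne_zero {L a : ℝ} (ha : a ≠ 0) (n : ℤ) : (a : ℂ) + freq L n ≠ 0 := by
  intro h
  have := congrArg Complex.re h
  rw [Complex.add_re, Complex.ofReal_re, freq_re, add_zero, Complex.zero_re] at this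
  exact ha this

theorem freq_ne_zero {L : ℝ} (hL : 0 < L) {n : ℤ} (hn : n ≠ 0) : freq L n ≠ 0 := by
  have hL' : (L : ℂ) ≠ 0 := by exact_mod_cast hL.ne'
  have hn' : (n : ℂ) ≠ 0 := by exact_mod_cast hn
  unfold freq
  have := Complex.two_pi_I_ne_zero
  positivity

theorem eBasis_eq_exp (L : ℝ) (n : ℤ) (x : ℝ) :
    eBasis L n x = (1 / Real.sqrt L : ℝ) * Complex.exp (freq L n * x) := by
  unfold eBasis freq
  congr 2
  ring

theorem conj_eBasis (L : ℝ) (n : ℤ) (x : ℝ) :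
    conj (eBasis L n x) = (1 / Real.sqrt L : ℝ) * Complex.exp (-freq L n * x) := by
  rw [eBasis_eq_exp, map_mul, Complex.conj_ofReal, ← Complex.exp_conj, map_mul, conj_freq,
    Complex.conj_ofReal]

theorem continuous_eBasis (L : ℝ) (n : ℤ) : Continuous (eBasis L n) := by
  unfold eBasis
  fun_prop

theorem memLp_eBasis (L : ℝ) (n : ℤ) :
    MemLp (eBasis L n) 2 (volume.restrict (Set.Ioc 0 L)) := by
  refine MemLp.of_bound (continuous_eBasis L n).aestronglyMeasurable |1 / Real.sqrt L|
    (Eventually.of_forall fun x => ?_)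
  rw [eBasis_eq_exp, norm_mul, norm_exp_freq_mul, mul_one, Complex.norm_real, Real.norm_eq_abs]

/-- The function `e_n` as an element of `L²(0, L)`. -/
def basisFun (L : ℝ) (n : ℤ) : L2 L := (memLp_eBasis L n).toLp

theorem inner_basisFun {L : ℝ} (n : ℤ) (f : L2 L) : inner ℂ (basisFun L n) f = coef f n := by
  rw [L2.inner_def, coef]
  refine integral_congr_ae ?_
  filter_upwards [(memLp_eBasis L n).coeFn_toLp] with x hx
  rw [basisFun, hx]
  simp

theorem integral_exp_mul_Ioc {L : ℝ} (hL : 0 < L) {z : ℂ} (hz : z ≠ 0) :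
    ∫ x in Set.Ioc 0 L, Complex.exp (z * x) = (Complex.exp (z * L) - 1) / z := by
  rw [← intervalIntegral.integral_of_le hL.le, integral_exp_mul_complex hz]
  simp

theorem inv_sqrt_mul_self {L : ℝ} (hL : 0 < L) :
    ((1 / Real.sqrt L : ℝ) : ℂ) * ((1 / Real.sqrt L : ℝ) : ℂ) = 1 / L := by
  rw [← Complex.ofReal_mul, div_mul_div_comm, Real.mul_self_sqrt hL.le]
  push_cast
  ring

theorem coef_basisFun {L : ℝ} (hL : 0 < L) (k n : ℤ) :
    coef (basisFun L k) n = if k = n then 1 else 0 := by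
  have h : coef (basisFun L k) n =
      ∫ x in Set.Ioc 0 L, (1 / L : ℂ) * Complex.exp (freq L (k - n) * (x : ℝ)) := by
    refine integral_congr_ae ?_
    filter_upwards [(memLp_eBasis L k).coeFn_toLp] with x hx
    rw [basisFun, hx, eBasis_eq_exp, conj_eBasis, mul_mul_mul_comm, inv_sqrt_mul_self hL,
      ← Complex.exp_add, freq_sub]
    ring_nf
  have hL' : (L : ℂ) ≠ 0 := by exact_mod_cast hL.ne'
  rw [h, integral_const_mul]
  split_ifs with hkn
  · simp [hkn, freq_zero, hL.le, hL']
  · rw [integral_exp_mul_Ioc hL (freq_ne_zero hL (sub_ne_zero.mpr hkn)), exp_freq_mul_period hL]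
    simp

theorem orthonormal_basisFun {L : ℝ} (hL : 0 < L) : Orthonormal ℂ (basisFun L) := by
  rw [orthonormal_iff_ite]
  intro i j
  rw [inner_basisFun, coef_basisFun hL]
  simp only [eq_comm]

/-- The Hilbert basis `(e_n)` of `L²(0, L)`. -/
def hilbertBasis {L : ℝ} (hL : 0 < L) : HilbertBasis ℤ ℂ (L2 L) :=
  HilbertBasis.mkOfOrthogonalEqBot (orthonormal_basisFun hL) (by
    rw [Submodule.eq_bot_iff]
    intro f hf
    refine eq_zero_of_coef f fun n => ?_
    rw [← inner_basisFun]
    exact (Submodule.mem_orthogonal _ f).mp hf _ (Submodule.subset_span ⟨n, rfl⟩))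

theorem hilbertBasis_apply {L : ℝ} (hL : 0 < L) (n : ℤ) : hilbertBasis hL n = basisFun L n := by
  rw [hilbertBasis, HilbertBasis.coe_mkOfOrthogonalEqBot]

theorem hilbertBasis_repr {L : ℝ} (hL : 0 < L) (f : L2 L) (n : ℤ) :
    (hilbertBasis hL).repr f n = coef f n := by
  rw [HilbertBasis.repr_apply_apply, hilbertBasis_apply, inner_basisFun]

theorem coef_ext {L : ℝ} {f g : L2 L} (h : ∀ n, coef f n = coef g n) : f = g := by
  rw [← sub_eq_zero]
  refine eq_zero_of_coef _ fun n => ?_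
  rw [sub_eq_add_neg, ← neg_one_smul ℂ, coef_add, coef_smul, h]
  ring

theorem hasSum_norm_sq_coef {L : ℝ} (hL : 0 < L) (f : L2 L) :
    HasSum (fun n => ‖coef f n‖ ^ 2) (‖f‖ ^ 2) := by
  have h := lp.hasSum_norm (p := 2) (by norm_num) ((hilbertBasis hL).repr f)
  simp only [ENNReal.toReal_ofNat, Real.rpow_ofNat, hilbertBasis_repr,
    LinearIsometryEquiv.norm_map] at h
  exact h

/-- Riesz–Fischer. -/
theorem exists_coef_eq {L : ℝ} (hL : 0 < L) {a : ℤ → ℂ} (ha : Summable fun n => ‖a n‖ ^ 2) :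
    ∃ f : L2 L, ∀ n, coef f n = a n := by
  have hm : Memℓp a 2 := by
    rw [memℓp_gen_iff (by norm_num)]
    simpa using ha
  refine ⟨(hilbertBasis hL).repr.symm ⟨a, hm⟩, fun n => ?_⟩
  rw [← hilbertBasis_repr hL, LinearIsometryEquiv.apply_symm_apply]

/-! ### Multiplication by an exponential -/

theorem exp_neg_mul_le {L a x : ℝ} (hx : x ∈ Set.Ioc 0 L) :
    Real.exp (-a * x) ≤ max 1 (Real.exp (-a * L)) := by
  rcases le_total 0 a with ha | ha
  · refine le_max_of_le_left (Real.exp_le_one_iff.mpr ?_)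
    nlinarith [hx.1]
  · refine le_max_of_le_right (Real.exp_le_exp.mpr ?_)
    nlinarith [hx.2]

theorem ae_norm_exp_mul_le {L : ℝ} (a : ℝ) (f : L2 L) :
    ∀ᵐ x ∂(volume.restrict (Set.Ioc 0 L)),
      ‖(Real.exp (-a * x) : ℂ) * f x‖ ≤ max 1 (Real.exp (-a * L)) * ‖f x‖ := by
  filter_upwards [ae_restrict_mem measurableSet_Ioc] with x hx
  rw [norm_mul, Complex.norm_real, Real.norm_of_nonneg (Real.exp_pos _).le]
  exact mul_le_mul_of_nonneg_right (exp_neg_mul_le hx) (norm_nonneg _)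

theorem memLp_exp_mul {L : ℝ} (a : ℝ) (f : L2 L) :
    MemLp (fun x : ℝ => (Real.exp (-a * x) : ℂ) * f x) 2 (volume.restrict (Set.Ioc 0 L)) := by
  refine (Lp.memLp f).of_le_mul ?_ (ae_norm_exp_mul_le a f)
  refine AEStronglyMeasurable.mul ?_ (Lp.aestronglyMeasurable f)
  exact Continuous.aestronglyMeasurable (by fun_prop)

/-- Multiplication by `exp (-a x)` on `L²(0, L)`. -/
def expMul (L a : ℝ) : L2 L →L[ℂ] L2 L :=
  LinearMap.mkContinuous
    { toFun := fun f => (memLp_exp_mul a f).toLp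
      map_add' := fun f g => by
        rw [← MemLp.toLp_add, MemLp.toLp_eq_toLp_iff]
        filter_upwards [Lp.coeFn_add f g] with x hx
        rw [Pi.add_apply, hx, Pi.add_apply, mul_add]
      map_smul' := fun z f => by
        rw [RingHom.id_apply, ← MemLp.toLp_const_smul, MemLp.toLp_eq_toLp_iff]
        filter_upwards [Lp.coeFn_smul z f] with x hx
        rw [Pi.smul_apply, hx, Pi.smul_apply, smul_eq_mul, smul_eq_mul, mul_left_comm] }
    (max 1 (Real.exp (-a * L))) fun f => by
      refine Lp.norm_le_mul_norm_of_ae_le_mul ?_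
      filter_upwards [ae_norm_exp_mul_le a f, (memLp_exp_mul a f).coeFn_toLp] with x hx hx'
      exact (congrArg norm hx').trans_le hx

theorem expMul_coeFn {L : ℝ} (a : ℝ) (f : L2 L) :
    expMul L a f =ᵐ[volume.restrict (Set.Ioc 0 L)] fun x => (Real.exp (-a * x) : ℂ) * f x :=
  (memLp_exp_mul a f).coeFn_toLp

theorem norm_expMul_le {L : ℝ} (a : ℝ) (f : L2 L) :
    ‖expMul L a f‖ ≤ max 1 (Real.exp (-a * L)) * ‖f‖ :=
  (expMul L a).le_of_opNorm_le
    (LinearMap.mkContinuous_norm_le _ (le_max_of_le_left zero_le_one) _) f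

theorem expMul_neg_expMul {L : ℝ} (a : ℝ) (f : L2 L) : expMul L (-a) (expMul L a f) = f := by
  apply Lp.ext
  filter_upwards [expMul_coeFn (-a) (expMul L a f), expMul_coeFn a f] with x h1 h2
  rw [h1, h2, ← mul_assoc, ← Complex.ofReal_mul, ← Real.exp_add]
  simp

theorem inner_expMul_left {L : ℝ} (a : ℝ) (f g : L2 L) :
    inner ℂ (expMul L a f) g = inner ℂ f (expMul L a g) := by
  rw [L2.inner_def, L2.inner_def]
  refine integral_congr_ae ?_
  filter_upwards [expMul_coeFn a f, expMul_coeFn a g] with x h1 h2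
  rw [h1, h2]
  simp only [RCLike.inner_apply, map_mul, Complex.conj_ofReal]
  ring

/-- The factor `e^{-aL}` is the same for all `n` and `p`, since the oscillating part of the
integrand has period `L`. Hence the kernel of the backstepping transformation is, up to a constant
and the factors `φ`, the matrix of a multiplication operator. -/
theorem coef_expMul_basisFun {L : ℝ} (hL : 0 < L) {a : ℝ} (ha : a ≠ 0) (n p : ℤ) :
    coef (expMul L a (basisFun L n)) p =
      ((1 - Real.exp (-a * L)) / L : ℝ) / (a + freq L (p - n)) := by
  have h : coef (expMul L a (basisFun L n)) p =
      ∫ x in Set.Ioc 0 L, (1 / L : ℂ) * Complex.exp (-(a + freq L (p - n)) * (x : ℝ)) := by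
    refine integral_congr_ae ?_
    filter_upwards [(memLp_eBasis L n).coeFn_toLp, expMul_coeFn a (basisFun L n)] with x hx hx'
    rw [hx', basisFun, hx, eBasis_eq_exp, conj_eBasis, mul_assoc, mul_mul_mul_comm,
      inv_sqrt_mul_self hL, ← Complex.exp_add, mul_left_comm, Complex.ofReal_exp,
      ← Complex.exp_add, freq_sub]
    push_cast
    ring_nf
  have hL' : (L : ℂ) ≠ 0 := by exact_mod_cast hL.ne'
  have hne := ofReal_add_freq_ne_zero (L := L) ha (p - n)
  rw [h, integral_const_mul, integral_exp_mul_Ioc hL (neg_ne_zero.mpr hne), neg_mul, add_mul,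
    neg_add, Complex.exp_add, ← neg_mul (freq L (p - n)), ← freq_neg, exp_freq_mul_period hL]
  push_cast
  rw [neg_mul]
  field_simp
  ring

/-- Parseval's identity for the pairing of `e^{-ax} e_p` with `f`, the multiplication being
self-adjoint because its symbol is real. -/
theorem hasSum_coef_expMul {L : ℝ} (hL : 0 < L) {a : ℝ} (ha : a ≠ 0) (f : L2 L) (p : ℤ) :
    HasSum (fun n => ((1 - Real.exp (-a * L)) / L : ℝ) / (a + freq L (p - n)) * coef f n)
      (coef (expMul L a f) p) := by
  have h := (hilbertBasis hL).hasSum_inner_mul_inner (expMul L a (basisFun L p)) f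
  simp only [inner_expMul_left, hilbertBasis_apply, inner_basisFun,
    coef_expMul_basisFun hL ha] at h
  exact h

/-! ### Translations -/

theorem toIocMod_eq_sub_int_mul {L : ℝ} (hL : 0 < L) (x : ℝ) :
    ∃ k : ℤ, toIocMod hL 0 x = x - k * L :=
  ⟨toIocDiv hL 0 x, by rw [toIocMod, zsmul_eq_mul]⟩

/-- The map factors through the circle: quotient map, rotation, and return to the fundamental
interval. -/
theorem measurePreserving_toIocMod_sub {L : ℝ} (hL : 0 < L) (t : ℝ) :
    MeasurePreserving (fun x => toIocMod hL 0 (x - t)) (volume.restrict (Set.Ioc 0 L))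
      (volume.restrict (Set.Ioc 0 L)) := by
  have : Fact (0 < L) := ⟨hL⟩
  have h1 := AddCircle.measurePreserving_mk L 0
  have h2 : MeasurePreserving (fun y : AddCircle L => y - (t : AddCircle L)) volume volume :=
    measurePreserving_sub_right volume _
  have h3 := AddCircle.measurePreserving_equivIoc (T := L) (a := 0)
  have h4 := measurePreserving_subtype_coe (μa := (volume : Measure ℝ))
    (measurableSet_Ioc (a := (0 : ℝ)) (b := 0 + L))
  have h : MeasurePreserving (fun x => toIocMod hL 0 (x - t))
      (volume.restrict (Set.Ioc 0 (0 + L))) (volume.restrict (Set.Ioc 0 (0 + L))) :=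
    h4.comp (h3.comp (h2.comp h1))
  rwa [zero_add] at h

/-- The translation `f ↦ f(· - t)` of `L`-periodic functions. -/
def translate {L : ℝ} (hL : 0 < L) (t : ℝ) (f : L2 L) : L2 L :=
  Lp.compMeasurePreserving _ (measurePreserving_toIocMod_sub hL t) f

theorem translate_coeFn {L : ℝ} (hL : 0 < L) (t : ℝ) (f : L2 L) :
    translate hL t f =ᵐ[volume.restrict (Set.Ioc 0 L)] fun x => f (toIocMod hL 0 (x - t)) :=
  Lp.coeFn_compMeasurePreserving f (measurePreserving_toIocMod_sub hL t)

theorem coef_translate {L : ℝ} (hL : 0 < L) (t : ℝ) (f : L2 L) (n : ℤ) :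
    coef (translate hL t f) n = Complex.exp (-freq L n * t) * coef f n := by
  have hτ := measurePreserving_toIocMod_sub hL t
  have h : coef (translate hL t f) n = ∫ x in Set.Ioc 0 L, Complex.exp (-freq L n * t) *
      (fun y => f y * conj (eBasis L n y)) (toIocMod hL 0 (x - t)) := by
    refine integral_congr_ae ?_
    filter_upwards [translate_coeFn hL t f] with x hx
    obtain ⟨k, hk⟩ := toIocMod_eq_sub_int_mul hL (x - t)
    -- The wrap-around moves the point by `k` whole periods, which `e_n` does not see.
    have hper : Complex.exp (-freq L n * ((k * L : ℝ) : ℂ)) = 1 := by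
      have := exp_freq_mul_period hL (-(n * k))
      rw [← this]
      congr 1
      unfold freq
      push_cast
      ring
    have he : Complex.exp (-freq L n * x) = Complex.exp (-freq L n * t) *
        (Complex.exp (-freq L n * (toIocMod hL 0 (x - t) : ℝ)) *
          Complex.exp (-freq L n * ((k * L : ℝ) : ℂ))) := by
      rw [← Complex.exp_add, ← Complex.exp_add, hk]
      congr 1
      push_cast
      ring
    simp only [hx, conj_eBasis]
    rw [he, hper]
    ring
  rw [h, integral_const_mul, coef]
  congr 1
  have hcomp : ∀ g : ℝ → ℂ, AEStronglyMeasurable g (volume.restrict (Set.Ioc 0 L)) →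
      ∫ x in Set.Ioc 0 L, g (toIocMod hL 0 (x - t)) = ∫ x in Set.Ioc 0 L, g x := by
    intro g hg
    rw [← hτ.map_eq] at hg
    rw [← integral_map hτ.aemeasurable hg, hτ.map_eq]
  exact hcomp _ (eBasis_integrable f n).aestronglyMeasurable

/-! ### Symmetric partial sums -/

theorem sum_Icc_neg_succ (g : ℤ → ℂ) (N : ℕ) :
    ∑ n ∈ Finset.Icc (-((N + 1 : ℕ) : ℤ)) ((N + 1 : ℕ) : ℤ), g n =
      ∑ n ∈ Finset.Icc (-(N : ℤ)) N, g n + (g (N + 1) + g (-(N + 1))) := by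
  have h : Finset.Icc (-((N + 1 : ℕ) : ℤ)) ((N + 1 : ℕ) : ℤ) =
      insert ((N : ℤ) + 1) (insert (-((N : ℤ) + 1)) (Finset.Icc (-(N : ℤ)) N)) := by
    ext k
    simp only [Finset.mem_Icc, Finset.mem_insert]
    omega
  rw [h, Finset.sum_insert, Finset.sum_insert]
  · ring
  · simp only [Finset.mem_Icc]
    omega
  · simp only [Finset.mem_Icc, Finset.mem_insert]
    omega

theorem sum_Icc_neg_eq_sum_range (g : ℤ → ℂ) (N : ℕ) :
    ∑ n ∈ Finset.Icc (-(N : ℤ)) N, g n =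
      g 0 + ∑ j ∈ Finset.range N, (g (j + 1) + g (-(j + 1))) := by
  induction N with
  | zero => simp
  | succ N ih => rw [sum_Icc_neg_succ, ih, Finset.sum_range_succ, add_assoc]

theorem sum_Icc_neg_shift (g : ℤ → ℂ) (N : ℕ) :
    ∑ n ∈ Finset.Icc (-(N : ℤ)) N, g (n + 1) =
      ∑ n ∈ Finset.Icc (-(N : ℤ)) N, g n + (g (N + 1) - g (-N)) := by
  induction N with
  | zero => simp
  | succ N ih =>
    rw [sum_Icc_neg_succ, sum_Icc_neg_succ, ih]
    push_cast
    have h1 : -((N : ℤ) + 1) + 1 = -N := by ring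
    rw [h1]
    ring

/-- A unit shift changes the symmetric sum only by two boundary terms, which vanish as `N → ∞`. No
absolute convergence is needed, and the sum of resolvents has none. -/
theorem tendsto_sum_Icc_neg_shift {g : ℤ → ℂ} (hg : Tendsto g cofinite (𝓝 0)) {s : ℂ}
    (h : Tendsto (fun N : ℕ => ∑ n ∈ Finset.Icc (-(N : ℤ)) N, g n) atTop (𝓝 s)) (k : ℤ) :
    Tendsto (fun N : ℕ => ∑ n ∈ Finset.Icc (-(N : ℤ)) N, g (n + k)) atTop (𝓝 s) := by
  have key : ∀ k : ℤ, Tendsto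
      (fun N : ℕ => g ((N : ℤ) + 1 + k) - g (-(N : ℤ) + k)) atTop (𝓝 0) := by
    intro k
    have h1 : Function.Injective fun N : ℕ => (N : ℤ) + 1 + k := fun a b hab => by
      simpa using hab
    have h2 : Function.Injective fun N : ℕ => -(N : ℤ) + k := fun a b hab => by
      simpa using hab
    rw [← sub_zero (0 : ℂ), ← Nat.cofinite_eq_atTop]
    exact (hg.comp h1.tendsto_cofinite).sub (hg.comp h2.tendsto_cofinite)
  have step : ∀ (k : ℤ) (N : ℕ), ∑ n ∈ Finset.Icc (-(N : ℤ)) N, g (n + (k + 1)) =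
      ∑ n ∈ Finset.Icc (-(N : ℤ)) N, g (n + k) + (g ((N : ℤ) + 1 + k) - g (-(N : ℤ) + k)) := by
    intro k N
    rw [← sum_Icc_neg_shift (fun n => g (n + k))]
    refine Finset.sum_congr rfl fun n _ => ?_
    congr 1
    ring
  induction k using Int.induction_on with
  | zero => simpa using h
  | succ k ih =>
    simp_rw [step]
    simpa using ih.add (key k)
  | pred k ih =>
    have h1 := ih.sub (key (-k - 1))
    rw [sub_zero] at h1
    refine h1.congr fun N => ?_
    have := step (-k - 1) N
    rw [sub_add_cancel] at this
    rw [this, add_sub_cancel_right]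

theorem tendsto_sum_Icc_neg_of_hasSum {g : ℤ → ℂ} {s : ℂ} (h : HasSum g s) :
    Tendsto (fun N : ℕ => ∑ n ∈ Finset.Icc (-(N : ℤ)) N, g n) atTop (𝓝 s) :=
  h.comp Finset.tendsto_Icc_neg

/-! ### The gain as the reciprocal of a symmetric sum of resolvents -/

theorem gain_pos {L lam : ℝ} (hL : 0 < L) (hlam : 0 < lam) : 0 < gain L lam := by
  have : Real.exp (-lam * L) < 1 := Real.exp_lt_one_iff.mpr (by nlinarith)
  have := Real.exp_pos (-lam * L)
  unfold gain
  have h : 0 < 1 - Real.exp (-lam * L) := by linarith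
  positivity

/-- The symmetric sum of `1 / (λ + 2iπn/L)`, from the partial fractions of the cotangent. -/
theorem tendsto_sum_resolvent {L lam : ℝ} (hL : 0 < L) (hlam : 0 < lam) :
    Tendsto (fun N : ℕ => ∑ n ∈ Finset.Icc (-(N : ℤ)) N, 1 / ((lam : ℂ) + freq L (-n))) atTop
      (𝓝 (1 / gain L lam : ℝ)) := by
  have hL' : (L : ℂ) ≠ 0 := by exact_mod_cast hL.ne'
  have hpi : (Real.pi : ℂ) ≠ 0 := by exact_mod_cast Real.pi_ne_zero
  -- Chosen so that `λ + 2iπn/L = (2πi/L)(z + n)`; the sum becomes the Mittag-Leffler series of `π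
  -- cot(πz)`.
  set z : ℂ := lam * L / (2 * Real.pi * Complex.I) with hz
  have hterm : ∀ n : ℤ, 1 / ((lam : ℂ) + freq L n) =
      L / (2 * Real.pi * Complex.I) * (1 / (z + n)) := by
    intro n
    have h0 := ofReal_add_freq_ne_zero (L := L) hlam.ne' n
    have h1 : (lam : ℂ) + freq L n = 2 * Real.pi * Complex.I / L * (z + n) := by
      rw [hz, freq]
      have := Complex.I_ne_zero
      field_simp
    have h2 : z + n ≠ 0 := fun h => h0 (by rw [h1, h, mul_zero])
    rw [h1]
    have := Complex.I_ne_zero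
    field_simp
  have hzc : z ∈ Complex.integerComplement := by
    rw [Complex.mem_integerComplement_iff]
    rintro ⟨n, hn⟩
    refine ofReal_add_freq_ne_zero (L := L) hlam.ne' (-n) ?_
    have h1 : (lam : ℂ) = 2 * Real.pi * Complex.I / L * z := by
      rw [hz]
      have := Complex.I_ne_zero
      field_simp
    rw [h1, ← hn, freq]
    push_cast
    ring
  -- The added `1 / z` is the term `n = 0`; each `cotTerm` pairs the terms `n` and `-n`.
  have hlim := ((tendsto_logDeriv_euler_cot_sub hzc).const_add (1 / z)).const_mul
    ((L : ℂ) / (2 * Real.pi * Complex.I))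
  have hval : (L : ℂ) / (2 * Real.pi * Complex.I) *
      (1 / z + (Real.pi * Complex.cot (Real.pi * z) - 1 / z)) = (1 / gain L lam : ℝ) := by
    have he : 2 * Real.pi * Complex.I * z = ((lam * L : ℝ) : ℂ) := by
      rw [hz]
      have := Complex.I_ne_zero
      push_cast
      field_simp
    have hE : 1 < Real.exp (lam * L) := Real.one_lt_exp_iff.mpr (by positivity)
    have hE0 := Real.exp_pos (lam * L)
    have hne : (1 : ℂ) - (Real.exp (lam * L) : ℂ) ≠ 0 := by
      rw [← Complex.ofReal_one, ← Complex.ofReal_sub]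
      exact_mod_cast (by linarith : 1 - Real.exp (lam * L) < 0).ne
    -- This is `(L/2) coth(λL/2)`, the value of the cotangent at the imaginary point `πz`.
    have hg : (1 / gain L lam : ℝ) =
        L / 2 * ((Real.exp (lam * L) + 1) / (Real.exp (lam * L) - 1)) := by
      have h1 : Real.exp (lam * L) - 1 ≠ 0 := by linarith
      rw [gain, neg_mul, Real.exp_neg]
      field_simp
    have hne' : (Real.exp (lam * L) : ℂ) - 1 ≠ 0 := by
      rw [← neg_sub]
      exact neg_ne_zero.mpr hne
    rw [hg, Complex.cot_pi_eq_exp_ratio, he, ← Complex.ofReal_exp]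
    push_cast
    push_cast at hne hne'
    have hI := Complex.I_ne_zero
    have h3 : (1 : ℂ) - Complex.exp (lam * L) = -(Complex.exp (lam * L) - 1) := by ring
    rw [h3]
    field_simp
    rw [Complex.I_sq]
    ring
  rw [hval] at hlim
  refine hlim.congr fun N => ?_
  rw [sum_Icc_neg_eq_sum_range]
  simp only [hterm]
  simp only [← mul_add]
  rw [← Finset.mul_sum, ← mul_add]
  congr 2
  · simp
  · refine Finset.sum_congr rfl fun j _ => ?_
    simp only [cotTerm]
    push_cast
    rw [neg_neg, sub_eq_add_neg, neg_add]

theorem tendsto_resolvent_cofinite {L lam : ℝ} (hL : 0 < L) :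
    Tendsto (fun n : ℤ => 1 / ((lam : ℂ) + freq L (-n))) cofinite (𝓝 0) := by
  have h : Tendsto (fun n : ℤ => ‖(lam : ℂ) + freq L (-n)‖) cofinite atTop := by
    have h1 : Tendsto (fun n : ℤ => ‖(n : ℝ)‖) cofinite atTop :=
      tendsto_norm_cocompact_atTop.comp Int.tendsto_coe_cofinite
    have h2 := h1.const_mul_atTop (show 0 < 2 * Real.pi / L by positivity)
    refine tendsto_atTop_mono (fun n => ?_) h2
    refine le_trans (le_of_eq ?_) (Complex.abs_im_le_norm _)
    have : ((lam : ℂ) + freq L (-n)).im = -(2 * Real.pi / L * n) := by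
      rw [freq_eq, Complex.add_im, Complex.ofReal_im, Complex.im_ofReal_mul, Complex.I_im]
      push_cast
      ring
    rw [this, abs_neg, abs_mul, abs_of_pos (by positivity), Real.norm_eq_abs]
  rw [tendsto_zero_iff_norm_tendsto_zero]
  refine h.inv_tendsto_atTop.congr fun n => ?_
  rw [Pi.inv_apply, one_div, norm_inv]

/-- Independence of `p` is the point: one scalar gain then serves all Fourier modes of the target
equation. -/
theorem tendsto_sum_resolvent_sub {L lam : ℝ} (hL : 0 < L) (hlam : 0 < lam) (p : ℤ) :
    Tendsto (fun N : ℕ => ∑ n ∈ Finset.Icc (-(N : ℤ)) N, 1 / ((lam : ℂ) + freq L (p - n))) atTop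
      (𝓝 (1 / gain L lam : ℝ)) := by
  have h := tendsto_sum_Icc_neg_shift (tendsto_resolvent_cofinite hL)
    (tendsto_sum_resolvent hL hlam) (-p)
  refine h.congr fun N => Finset.sum_congr rfl fun n _ => ?_
  rw [neg_add, neg_neg, neg_add_eq_sub]

/-! ### The spaces `H^s_per` -/

theorem weight_pos (L : ℝ) (s : ℕ) (n : ℤ) : 0 < weight L s n := by unfold weight; positivity

theorem one_le_weight (L : ℝ) (s : ℕ) (n : ℤ) : 1 ≤ weight L s n :=
  le_add_of_nonneg_right (by positivity)

namespace HPer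

variable {L : ℝ} {s : ℕ}

theorem coef_add (f g : HPer L s) (n : ℤ) : (f + g).coef n = f.coef n + g.coef n :=
  TransportStab.coef_add f.1 g.1 n

theorem coef_smul (a : ℂ) (f : HPer L s) (n : ℤ) : (a • f).coef n = a * f.coef n :=
  TransportStab.coef_smul a f.1 n

theorem coef_real_smul (a : ℝ) (f : HPer L s) (n : ℤ) : (a • f).coef n = a * f.coef n :=
  coef_smul (a : ℂ) f n

theorem coef_sub (f g : HPer L s) (n : ℤ) : (f - g).coef n = f.coef n - g.coef n := by
  rw [sub_eq_add_neg, ← neg_one_smul ℂ, coef_add, coef_smul]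
  ring

theorem ext {f g : HPer L s} (h : ∀ n, f.coef n = g.coef n) : f = g :=
  Subtype.ext (coef_ext h)

theorem summable (f : HPer L s) : Summable fun n => weight L s n * ‖f.coef n‖ ^ 2 := f.2

theorem exists_coef_eq (hL : 0 < L) {a : ℤ → ℂ}
    (ha : Summable fun n => weight L s n * ‖a n‖ ^ 2) :
    ∃ f : HPer L s, ∀ n, f.coef n = a n := by
  obtain ⟨f, hf⟩ := TransportStab.exists_coef_eq hL (a := a) <| by
    refine Summable.of_nonneg_of_le (fun n => by positivity) (fun n => ?_) ha
    exact le_mul_of_one_le_left (by positivity) (one_le_weight L s n)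
  refine ⟨⟨f, ?_⟩, hf⟩
  change Summable fun n => weight L s n * ‖TransportStab.coef f n‖ ^ 2
  simpa only [hf] using ha

theorem norm_coef_le (f : HPer L s) (n : ℤ) : ‖f.coef n‖ ≤ ‖f‖ := by
  refine le_of_pow_le_pow_left₀ two_ne_zero (norm_nonneg _) ?_
  rw [norm_sq_eq]
  refine le_trans ?_ (f.summable.le_tsum n fun k _ => mul_nonneg (weight_pos L s k).le (by positivity))
  exact le_mul_of_one_le_left (by positivity) (one_le_weight L s n)

/-- The `n`-th Fourier coefficient as a continuous linear functional. -/
def coefL (n : ℤ) : HPer L s →L[ℂ] ℂ :=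
  LinearMap.mkContinuous
    { toFun := fun f => f.coef n
      map_add' := fun f g => coef_add f g n
      map_smul' := fun a f => coef_smul a f n } 1
    fun f => by rw [one_mul]; exact norm_coef_le f n

theorem coefL_apply (n : ℤ) (f : HPer L s) : coefL n f = f.coef n := rfl

/-- A multiplier comparable with `(1 + |2iπn/L|^{2s})^{-1/2}` maps `L²` onto `H^s_per`. -/
theorem exists_multiplierEquiv (hL : 0 < L) {q : ℤ → ℂ} {c C : ℝ} (hc : 0 < c)
    (hlow : ∀ n, c / Real.sqrt (weight L s n) ≤ ‖q n‖)
    (hup : ∀ n, ‖q n‖ ≤ C / Real.sqrt (weight L s n)) :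
    ∃ Φ : HPer L s ≃L[ℂ] L2 L, (∀ α n, α.coef n = q n * TransportStab.coef (Φ α) n) ∧
      (∀ α, ‖Φ α‖ ≤ c⁻¹ * ‖α‖) ∧ ∀ f, ‖Φ.symm f‖ ≤ C * ‖f‖ := by
  have hw : ∀ n, 0 < Real.sqrt (weight L s n) := fun n => Real.sqrt_pos.mpr (weight_pos L s n)
  have hq : ∀ n, q n ≠ 0 := fun n => norm_pos_iff.mp ((div_pos hc (hw n)).trans_le (hlow n))
  have hC : 0 ≤ C := by
    have := (norm_nonneg _).trans (hup 0)
    exact (div_nonneg_iff.mp this).elim And.left fun h => absurd h.2 (hw 0).not_ge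
  -- Squared, the hypotheses read `c² ≤ weight · |q_n|² ≤ C²`: dividing and multiplying by `q` are
  -- bounded termwise, by `1/c` and `C`.
  have hlow' : ∀ n, c ^ 2 ≤ weight L s n * ‖q n‖ ^ 2 := fun n => by
    have h := (div_le_iff₀ (hw n)).mp (hlow n)
    calc c ^ 2 ≤ (‖q n‖ * Real.sqrt (weight L s n)) ^ 2 := by gcongr
      _ = _ := by rw [mul_pow, Real.sq_sqrt (weight_pos L s n).le, mul_comm]
  have hup' : ∀ n, weight L s n * ‖q n‖ ^ 2 ≤ C ^ 2 := fun n => by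
    have h := (le_div_iff₀ (hw n)).mp (hup n)
    calc _ = (‖q n‖ * Real.sqrt (weight L s n)) ^ 2 := by
          rw [mul_pow, Real.sq_sqrt (weight_pos L s n).le, mul_comm]
      _ ≤ C ^ 2 := by have := (hw n).le; gcongr
  have hdiv : ∀ (α : HPer L s) n,
      ‖α.coef n / q n‖ ^ 2 ≤ (c⁻¹) ^ 2 * (weight L s n * ‖α.coef n‖ ^ 2) := fun α n => by
    have := norm_pos_iff.mpr (hq n)
    rw [norm_div, div_pow, inv_pow, inv_mul_eq_div, div_le_div_iff₀ (by positivity) (by positivity)]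
    nlinarith [mul_le_mul_of_nonneg_left (hlow' n) (sq_nonneg ‖α.coef n‖)]
  have hmul : ∀ (f : L2 L) n,
      weight L s n * ‖q n * TransportStab.coef f n‖ ^ 2 ≤
        C ^ 2 * ‖TransportStab.coef f n‖ ^ 2 := fun f n => by
    rw [norm_mul, mul_pow, ← mul_assoc]
    exact mul_le_mul_of_nonneg_right (hup' n) (sq_nonneg _)
  have hmulS : ∀ f : L2 L, Summable fun n => weight L s n * ‖q n * TransportStab.coef f n‖ ^ 2 :=
    fun f => Summable.of_nonneg_of_le
      (fun n => mul_nonneg (weight_pos L s n).le (by positivity)) (hmul f)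
      ((hasSum_norm_sq_coef hL f).summable.mul_left _)
  have hdivS : ∀ α : HPer L s, Summable fun n => ‖α.coef n / q n‖ ^ 2 :=
    fun α => Summable.of_nonneg_of_le (fun n => by positivity) (hdiv α) (α.summable.mul_left _)
  choose D hD using fun α : HPer L s => TransportStab.exists_coef_eq hL (hdivS α)
  choose M hM using fun f : L2 L => HPer.exists_coef_eq hL (hmulS f)
  let e : HPer L s ≃ₗ[ℂ] L2 L :=
    { toFun := D
      invFun := M
      map_add' := fun α β => TransportStab.coef_ext fun n => by
        rw [TransportStab.coef_add, hD, hD, hD, coef_add, add_div]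
      map_smul' := fun a α => TransportStab.coef_ext fun n => by
        rw [RingHom.id_apply, TransportStab.coef_smul, hD, hD, coef_smul, mul_div_assoc]
      left_inv := fun α => HPer.ext fun n => by rw [hM, hD, mul_div_cancel₀ _ (hq n)]
      right_inv := fun f => TransportStab.coef_ext fun n => by
        rw [hD, hM, mul_div_cancel_left₀ _ (hq n)] }
  have he : ∀ α, ‖e α‖ ≤ c⁻¹ * ‖α‖ := fun α => by
    refine le_of_pow_le_pow_left₀ two_ne_zero (by positivity) ?_
    rw [mul_pow, norm_sq_eq, ← (hasSum_norm_sq_coef hL (e α)).tsum_eq, ← tsum_mul_left]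
    refine Summable.tsum_le_tsum (fun n => ?_) (hasSum_norm_sq_coef hL (e α)).summable
      (α.summable.mul_left _)
    rw [show TransportStab.coef (e α) n = _ from hD α n]
    exact hdiv α n
  have he' : ∀ f, ‖e.symm f‖ ≤ C * ‖f‖ := fun f => by
    refine le_of_pow_le_pow_left₀ two_ne_zero (by positivity) ?_
    rw [mul_pow, norm_sq_eq, ← (hasSum_norm_sq_coef hL f).tsum_eq, ← tsum_mul_left]
    refine Summable.tsum_le_tsum (fun n => ?_) (e.symm f).summable
      ((hasSum_norm_sq_coef hL f).summable.mul_left _)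
    rw [show (e.symm f).coef n = _ from hM f n]
    exact hmul f n
  refine ⟨e.toContinuousLinearEquivOfBounds _ _ he he', fun α n => ?_, he, he'⟩
  rw [show TransportStab.coef (e.toContinuousLinearEquivOfBounds _ _ he he' α) n = _ from hD α n,
    mul_div_cancel₀ _ (hq n)]

/-- Completeness is transported from `L²` through the multiplier `weight^{-1/2}`. It is required to
integrate functions of time with values in this space. -/
theorem completeSpace (hL : 0 < L) : CompleteSpace (HPer L s) := by
  have h : ∀ n, ‖((1 / Real.sqrt (weight L s n) : ℝ) : ℂ)‖ = 1 / Real.sqrt (weight L s n) :=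
    fun n => by rw [Complex.norm_real, Real.norm_of_nonneg (by positivity)]
  obtain ⟨Φ, -⟩ := exists_multiplierEquiv (s := s) hL
    (q := fun n => ((1 / Real.sqrt (weight L s n) : ℝ) : ℂ)) one_pos
    (fun n => (h n).ge) (fun n => (h n).le)
  exact (completeSpace_congr (e := Φ.toEquiv) Φ.isUniformEmbedding).mpr inferInstance

/-! ### The transport semigroup -/

/-- The rate `ν + 2iπn/L` of decay of the `n`-th Fourier mode under `z_t + z_x + ν z = 0`. -/
def rate (L ν : ℝ) (n : ℤ) : ℂ := ν + freq L n

theorem norm_exp_rate (L ν : ℝ) (n : ℤ) (t : ℝ) :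
    ‖Complex.exp (-rate L ν n * t)‖ = Real.exp (-ν * t) := by
  rw [Complex.norm_exp, rate]
  congr 1
  simp [freq_re]

theorem coef_exp_translate (hL : 0 < L) (ν t : ℝ) (f : L2 L) (n : ℤ) :
    TransportStab.coef ((Real.exp (-ν * t) : ℂ) • translate hL t f) n =
      Complex.exp (-rate L ν n * t) * TransportStab.coef f n := by
  rw [TransportStab.coef_smul, coef_translate, ← mul_assoc, Complex.ofReal_exp, ← Complex.exp_add]
  congr 2
  rw [rate]
  push_cast
  ring

theorem exp_translate_mem (hL : 0 < L) (ν t : ℝ) (f : HPer L s) :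
    (Real.exp (-ν * t) : ℂ) • translate hL t f.1 ∈ perSobolev L s := by
  change Summable fun n => weight L s n * ‖TransportStab.coef _ n‖ ^ 2
  refine (f.summable.mul_left (Real.exp (-ν * t) ^ 2)).congr fun n => ?_
  rw [coef_exp_translate, norm_mul, norm_exp_rate, mul_pow]
  exact mul_left_comm _ _ _

/-- The operator `f ↦ exp (-ν t) f(· - t)` on `H^s_per`. -/
def transportFun (hL : 0 < L) (ν t : ℝ) (f : HPer L s) : HPer L s :=
  ⟨(Real.exp (-ν * t) : ℂ) • translate hL t f.1, exp_translate_mem hL ν t f⟩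

theorem coef_transportFun (hL : 0 < L) (ν t : ℝ) (f : HPer L s) (n : ℤ) :
    (transportFun hL ν t f).coef n = Complex.exp (-rate L ν n * t) * f.coef n :=
  coef_exp_translate hL ν t f.1 n

theorem norm_transportFun (hL : 0 < L) (ν t : ℝ) (f : HPer L s) :
    ‖transportFun hL ν t f‖ = Real.exp (-ν * t) * ‖f‖ := by
  rw [← sq_eq_sq₀ (norm_nonneg _) (by positivity), mul_pow, norm_sq_eq, norm_sq_eq,
    ← tsum_mul_left]
  refine tsum_congr fun n => ?_
  rw [coef_transportFun, norm_mul, norm_exp_rate, mul_pow, mul_left_comm]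

/-- The transport semigroup `f ↦ exp (-ν t) f(· - t)` on `H^s_per`. -/
def transport (hL : 0 < L) (ν t : ℝ) : HPer L s →L[ℂ] HPer L s :=
  LinearMap.mkContinuous
    { toFun := transportFun hL ν t
      map_add' := fun f g => HPer.ext fun n => by
        simp only [coef_add, coef_transportFun, mul_add]
      map_smul' := fun a f => HPer.ext fun n => by
        simp only [coef_smul, coef_transportFun, RingHom.id_apply, mul_left_comm] }
    (Real.exp (-ν * t)) fun f => (norm_transportFun hL ν t f).le

theorem coef_transport (hL : 0 < L) (ν t : ℝ) (f : HPer L s) (n : ℤ) :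
    (transport hL ν t f).coef n = Complex.exp (-rate L ν n * t) * f.coef n :=
  coef_transportFun hL ν t f n

theorem norm_transport (hL : 0 < L) (ν t : ℝ) (f : HPer L s) :
    ‖transport hL ν t f‖ = Real.exp (-ν * t) * ‖f‖ :=
  norm_transportFun hL ν t f

theorem isTransport_transport (hL : 0 < L) (ν : ℝ) :
    IsTransport hL ν (fun t => (transport hL ν t : HPer L s →L[ℂ] HPer L s)) := by
  intro t _ α
  filter_upwards [translate_coeFn hL t α.1,
    Lp.coeFn_smul (Real.exp (-ν * t) : ℂ) (translate hL t α.1)] with x h1 h2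
  change ((Real.exp (-ν * t) : ℂ) • translate hL t α.1 : L2 L) x = _
  rw [h2, Pi.smul_apply, h1, smul_eq_mul]
  rfl

/-- Dominated convergence in the series for the squared norm: each mode is continuous in `t`, and
for `t` near `t₀` the exponentials are bounded uniformly in `n`. -/
theorem continuous_transport (hL : 0 < L) (ν : ℝ) (f : HPer L s) :
    Continuous fun t => transport hL ν t f := by
  rw [continuous_iff_continuousAt]
  intro t₀
  have hsq : Tendsto (fun t => ‖transport hL ν t f - transport hL ν t₀ f‖ ^ 2) (𝓝 t₀) (𝓝 0) := by
    have hexp : ∀ n, Continuous fun t : ℝ => Complex.exp (-rate L ν n * t) := fun n => by fun_prop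
    have hb : ∀ᶠ t : ℝ in 𝓝 t₀, Real.exp (-ν * t) ≤ Real.exp (-ν * t₀) + 1 := by
      have hcont : Continuous fun t : ℝ => Real.exp (-ν * t) := by fun_prop
      exact (hcont.tendsto t₀).eventually (ge_mem_nhds (lt_add_one _))
    have h := tendsto_tsum_of_dominated_convergence (𝓕 := 𝓝 t₀)
      (f := fun (t : ℝ) n => weight L s n *
        ‖(transport hL ν t f - transport hL ν t₀ f).coef n‖ ^ 2)
      (g := fun _ => 0)
      (f.summable.mul_left ((Real.exp (-ν * t₀) + 1 + Real.exp (-ν * t₀)) ^ 2)) ?_ ?_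
    · simp only [tsum_zero] at h
      refine h.congr fun t => ?_
      rw [norm_sq_eq]
    · intro n
      have h1 := ((((hexp n).tendsto t₀).mul_const (f.coef n)).sub_const
        (Complex.exp (-rate L ν n * t₀) * f.coef n)).norm
      have h2 := (h1.pow 2).const_mul (weight L s n)
      simpa [coef_sub, coef_transport] using h2
    · filter_upwards [hb] with t ht n
      have hw := (weight_pos L s n).le
      rw [Real.norm_of_nonneg (by positivity), mul_left_comm, coef_sub, coef_transport,
        coef_transport, ← sub_mul, norm_mul, mul_pow]
      refine mul_le_mul_of_nonneg_left ?_ hw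
      refine mul_le_mul_of_nonneg_right ?_ (by positivity)
      refine pow_le_pow_left₀ (norm_nonneg _) ((norm_sub_le _ _).trans ?_) 2
      rw [norm_exp_rate, norm_exp_rate]
      exact add_le_add_left ht _
  rw [ContinuousAt, tendsto_iff_norm_sub_tendsto_zero]
  have := hsq.sqrt
  simpa [Real.sqrt_sq] using this

theorem isC0Semigroup_transport (hL : 0 < L) (ν : ℝ) :
    IsC0Semigroup fun t => (transport hL ν t : HPer L s →L[ℂ] HPer L s) where
  zero := ContinuousLinearMap.ext fun f => HPer.ext fun n => by
    simp [coef_transport]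
  add t r _ _ := ContinuousLinearMap.ext fun f => HPer.ext fun n => by
    rw [ContinuousLinearMap.comp_apply, coef_transport, coef_transport, coef_transport,
      ← mul_assoc, ← Complex.exp_add]
    push_cast
    ring_nf
  cont f := (continuous_transport hL ν f).continuousOn

/-- The Fourier coefficients of `z_t + z_x + ν z = 0` integrated in time. -/
theorem rate_mul_coef_integral_transport (hL : 0 < L) (ν t : ℝ) (f : HPer L s) (n : ℤ) :
    -rate L ν n * (∫ r in (0 : ℝ)..t, transport hL ν r f).coef n =
      (transport hL ν t f - f).coef n := by
  have := completeSpace (s := s) hL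
  have h1 : (∫ r in (0 : ℝ)..t, transport hL ν r f).coef n =
      ∫ r in (0 : ℝ)..t, Complex.exp (-rate L ν n * r) * f.coef n := by
    rw [← coefL_apply, ← ContinuousLinearMap.intervalIntegral_comp_comm _
      ((continuous_transport hL ν f).intervalIntegrable _ _)]
    simp only [coefL_apply, coef_transport]
  rw [h1, coef_sub, coef_transport]
  -- The rate can vanish (`ν = 0`, `n = 0`); that mode is constant in time and both sides are zero.
  by_cases hr : rate L ν n = 0
  · simp [hr]
  · rw [intervalIntegral.integral_mul_const, integral_exp_mul_complex (neg_ne_zero.mpr hr)]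
    have : -rate L ν n ≠ 0 := neg_ne_zero.mpr hr
    simp only [Complex.ofReal_zero, mul_zero, Complex.exp_zero]
    rw [← mul_assoc, mul_div_cancel₀ _ this]
    ring

/-- The generator of the transport semigroup is `-∂_x - ν` with its maximal domain. -/
theorem isGenValue_transport_iff (hL : 0 < L) (ν : ℝ) (f g : HPer L s) :
    IsGenValue (fun t => transport hL ν t) f g ↔ ∀ n, g.coef n = -rate L ν n * f.coef n := by
  constructor
  · intro h n
    have h1 := ((coefL n).continuous.tendsto g).comp h
    have h2 : HasDerivAt (fun t : ℝ => Complex.exp (-rate L ν n * t) * f.coef n)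
        (-rate L ν n * f.coef n) 0 := by
      have h3 := (((hasDerivAt_id (0 : ℝ)).ofReal_comp.const_mul (-rate L ν n)).cexp).mul_const
        (f.coef n)
      simpa using h3
    have h3 := h2.tendsto_slope_zero_right
    refine tendsto_nhds_unique (h1.congr fun t => ?_) h3
    rw [Function.comp_apply, coefL_apply, coef_real_smul, coef_sub, coef_transport, zero_add]
    simp [Complex.real_smul]
  · intro h
    have := completeSpace (s := s) hL
    -- The candidate `g` is integrated along the semigroup, so that the difference quotient becomes
    -- an average of a continuous function.
    have hint : ∀ t : ℝ, transport hL ν t f - f = ∫ r in (0 : ℝ)..t, transport hL ν r g := by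
      intro t
      refine HPer.ext fun n => ?_
      rw [← rate_mul_coef_integral_transport, ← coefL_apply, ← coefL_apply,
        ← ContinuousLinearMap.intervalIntegral_comp_comm _
          ((continuous_transport hL ν f).intervalIntegrable _ _),
        ← ContinuousLinearMap.intervalIntegral_comp_comm _
          ((continuous_transport hL ν g).intervalIntegrable _ _),
        ← intervalIntegral.integral_const_mul]
      simp only [coefL_apply, coef_transport, h, mul_left_comm]
    have hd := intervalIntegral.integral_hasDerivAt_right
      ((continuous_transport hL ν g).intervalIntegrable 0 0)
      ((continuous_transport hL ν g).stronglyMeasurableAtFilter _ _)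
      (continuous_transport hL ν g).continuousAt
    have h0 : transport hL ν 0 g = g := HPer.ext fun n => by simp [coef_transport]
    rw [h0] at hd
    have h1 := hd.tendsto_slope_zero_right
    refine h1.congr fun t => ?_
    rw [zero_add, intervalIntegral.integral_same, sub_zero, hint]

end HPer

/-! ### Conjugation of semigroups -/

section Conjugation

variable {X : Type*} [NormedAddCommGroup X] [NormedSpace ℂ X]

/-- The family `T⁻¹ R(t) T`. -/
def conjFamily (T : X ≃L[ℂ] X) (R : ℝ → X →L[ℂ] X) (t : ℝ) : X →L[ℂ] X :=
  (T.symm : X →L[ℂ] X).comp ((R t).comp (T : X →L[ℂ] X))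

theorem conjFamily_apply (T : X ≃L[ℂ] X) (R : ℝ → X →L[ℂ] X) (t : ℝ) (x : X) :
    conjFamily T R t x = T.symm (R t (T x)) := rfl

theorem IsC0Semigroup.conjFamily {R : ℝ → X →L[ℂ] X} (hR : IsC0Semigroup R) (T : X ≃L[ℂ] X) :
    IsC0Semigroup (conjFamily T R) where
  zero := ContinuousLinearMap.ext fun x => by
    rw [conjFamily_apply, hR.zero]
    simp
  add s t hs ht := ContinuousLinearMap.ext fun x => by
    simp [conjFamily_apply, hR.add s t hs ht]
  cont x := T.symm.continuous.comp_continuousOn (hR.cont (T x))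

theorem isGenValue_conjFamily_iff (T : X ≃L[ℂ] X) (R : ℝ → X →L[ℂ] X) (x y : X) :
    IsGenValue (conjFamily T R) x y ↔ IsGenValue R (T x) (T y) := by
  have hreal : ∀ (S : X ≃L[ℂ] X) (h : ℝ) (z : X), S (h • z) = h • S z := fun S h z =>
    S.map_smul (h : ℂ) z
  constructor
  · intro h
    refine ((T.continuous.tendsto y).comp h).congr fun t => ?_
    rw [Function.comp_apply, hreal, map_sub, conjFamily_apply, T.apply_symm_apply]
  · intro h
    have h1 := (T.symm.continuous.tendsto (T y)).comp h
    rw [T.symm_apply_apply] at h1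
    refine h1.congr fun t => ?_
    rw [Function.comp_apply, hreal, map_sub, conjFamily_apply, T.symm_apply_apply]

end Conjugation

/-! ### The closed-loop operator in the new variables -/

theorem exp_neg_lt_one {L lam : ℝ} (hL : 0 < L) (hlam : 0 < lam) : Real.exp (-lam * L) < 1 :=
  Real.exp_lt_one_iff.mpr (by nlinarith)

/-- With `g_n = -(2iπn/L + μ) f_n + u`, the `n`-th term of row `p` of the target equation is, after
division by `(1 - e^{-λL}) / L`, exactly `f_n + u / (λ + 2iπ(p-n)/L)`, since `(λ + μ + 2iπp/L) -
(2iπn/L + μ)` is the denominator of the kernel. Summation over `n` shows that the pairing exists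
automatically, and its value measures the defect in the target equation. -/
theorem tendsto_sum_coef_of_eq {L lam μ : ℝ} (hL : 0 < L) (hlam : 0 < lam) {f g : L2 L} {u : ℂ}
    (h : ∀ n, coef g n = -(freq L n * coef f n) - μ * coef f n + u) (p : ℤ) :
    Tendsto (fun N : ℕ => ∑ n ∈ Finset.Icc (-(N : ℤ)) N, coef f n) atTop
      (𝓝 ((coef (expMul L lam g) p + HPer.rate L (lam + μ) p * coef (expMul L lam f) p) /
        ((1 - Real.exp (-lam * L)) / L : ℝ) - u * (1 / gain L lam : ℝ))) := by
  have hk : (((1 - Real.exp (-lam * L)) / L : ℝ) : ℂ) ≠ 0 := by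
    have := exp_neg_lt_one hL hlam
    exact_mod_cast (div_pos (by linarith) hL : 0 < (1 - Real.exp (-lam * L)) / L).ne'
  have h1 := ((tendsto_sum_Icc_neg_of_hasSum ((hasSum_coef_expMul hL hlam.ne' g p).add
    ((hasSum_coef_expMul hL hlam.ne' f p).mul_left (HPer.rate L (lam + μ) p)))).div_const
    (((1 - Real.exp (-lam * L)) / L : ℝ) : ℂ)).sub
    ((tendsto_sum_resolvent_sub hL hlam p).const_mul u)
  refine h1.congr fun N => ?_
  rw [Finset.sum_div, Finset.mul_sum, ← Finset.sum_sub_distrib]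
  refine Finset.sum_congr rfl fun n _ => ?_
  have hne := ofReal_add_freq_ne_zero (L := L) hlam.ne' (p - n)
  rw [h, HPer.rate]
  generalize (((1 - Real.exp (-lam * L)) / L : ℝ) : ℂ) = k at hk
  field_simp
  rw [freq_sub]
  push_cast
  ring

/-- The same cancellation for the inverse multiplication `e^{λx}`: the denominator `-λ + 2iπ(n-p)/L`
disappears, and `g_n + (2iπn/L + μ) f_n` becomes a sum over `p` that no longer depends on `n`. That
sum is the control `u`. -/
theorem exists_eq_of_expMul {L lam μ : ℝ} (hL : 0 < L) (hlam : 0 < lam) {f g : L2 L}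
    (h : ∀ p, coef (expMul L lam g) p = -HPer.rate L (lam + μ) p * coef (expMul L lam f) p) :
    ∃ u : ℂ, ∀ n, coef g n = -(freq L n * coef f n) - μ * coef f n + u := by
  have key : ∀ n, HasSum
      (fun p => (((1 - Real.exp (- -lam * L)) / L : ℝ) : ℂ) * coef (expMul L lam f) p)
      (coef g n + (freq L n + μ) * coef f n) := by
    intro n
    have h1 := (hasSum_coef_expMul hL (neg_ne_zero.mpr hlam.ne') (expMul L lam g) n).add
      ((hasSum_coef_expMul hL (neg_ne_zero.mpr hlam.ne') (expMul L lam f) n).mul_left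
        (freq L n + μ))
    rw [expMul_neg_expMul, expMul_neg_expMul] at h1
    refine h1.congr_fun fun p => ?_
    have hne := ofReal_add_freq_ne_zero (L := L) (neg_ne_zero.mpr hlam.ne') (n - p)
    rw [h, HPer.rate]
    generalize (((1 - Real.exp (- -lam * L)) / L : ℝ) : ℂ) = k
    field_simp
    rw [freq_sub]
    push_cast
    ring
  refine ⟨coef g 0 + (freq L 0 + μ) * coef f 0, fun n => ?_⟩
  rw [(key 0).unique (key n)]
  ring

/-- The symmetric sum of the `f_n` is a multiple of the defect minus `u / K`. Hence the feedback
relation `u = -K ∑ f_n` holds exactly when the defect is zero. -/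
theorem expMul_coef_eq_iff {L lam μ : ℝ} (hL : 0 < L) (hlam : 0 < lam) (f g : L2 L) :
    (∀ p, coef (expMul L lam g) p = -HPer.rate L (lam + μ) p * coef (expMul L lam f) p) ↔
      ∃ u : ℂ, Tendsto (fun N : ℕ => ∑ n ∈ Finset.Icc (-(N : ℤ)) N, -(gain L lam : ℂ) * coef f n)
          atTop (𝓝 u) ∧
        ∀ n, coef g n = -(freq L n * coef f n) - μ * coef f n + u := by
  have hK : (gain L lam : ℂ) ≠ 0 := by exact_mod_cast (gain_pos hL hlam).ne'
  have hk : (((1 - Real.exp (-lam * L)) / L : ℝ) : ℂ) ≠ 0 := by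
    have := exp_neg_lt_one hL hlam
    exact_mod_cast (div_pos (by linarith) hL : 0 < (1 - Real.exp (-lam * L)) / L).ne'
  simp_rw [← Finset.mul_sum]
  constructor
  · intro h
    obtain ⟨u, hu⟩ := exists_eq_of_expMul hL hlam h
    refine ⟨u, ?_, hu⟩
    have h1 := (tendsto_sum_coef_of_eq hL hlam hu 0).const_mul (-(gain L lam : ℂ))
    rw [h] at h1
    convert h1 using 2
    push_cast
    field_simp
    ring
  · rintro ⟨u, hu, h⟩ p
    have h1 := (tendsto_sum_coef_of_eq hL hlam h p).const_mul (-(gain L lam : ℂ))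
    have h2 := tendsto_nhds_unique hu h1
    generalize (((1 - Real.exp (-lam * L)) / L : ℝ) : ℂ) = k at *
    push_cast at h2
    field_simp at h2
    rw [neg_mul, ← add_eq_zero_iff_eq_neg]
    refine (mul_eq_zero.mp ?_).resolve_left hK
    linear_combination h2

/-! ### The transformation -/

/-- Multiplication by `2 / (1 + exp (-λL)) exp (-λx)` as an automorphism of `L²(0, L)`. -/
def expMulEquiv (L lam : ℝ) : L2 L ≃L[ℂ] L2 L :=
  ContinuousLinearEquiv.equivOfInverse
    (((2 / (1 + Real.exp (-lam * L)) : ℝ) : ℂ) • expMul L lam)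
    (((2 / (1 + Real.exp (-lam * L)) : ℝ) : ℂ)⁻¹ • expMul L (-lam))
    (fun f => by
      have h : ((2 / (1 + Real.exp (-lam * L)) : ℝ) : ℂ) ≠ 0 := by
        exact_mod_cast (by positivity : 2 / (1 + Real.exp (-lam * L)) ≠ 0)
      simp only [_root_.smul_apply, map_smul, expMul_neg_expMul]
      rw [smul_smul, mul_inv_cancel₀ h, one_smul])
    (fun f => by
      have h : ((2 / (1 + Real.exp (-lam * L)) : ℝ) : ℂ) ≠ 0 := by
        exact_mod_cast (by positivity : 2 / (1 + Real.exp (-lam * L)) ≠ 0)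
      have h1 : expMul L lam (expMul L (-lam) f) = f := by
        simpa using expMul_neg_expMul (-lam) f
      simp only [_root_.smul_apply, map_smul, h1]
      rw [smul_smul, inv_mul_cancel₀ h, one_smul])

theorem coef_expMulEquiv {L lam : ℝ} (f : L2 L) (n : ℤ) :
    coef (expMulEquiv L lam f) n =
      ((2 / (1 + Real.exp (-lam * L)) : ℝ) : ℂ) * coef (expMul L lam f) n :=
  coef_smul _ _ n

theorem norm_expMulEquiv_le {L lam : ℝ} (hL : 0 < L) (hlam : 0 < lam) (f : L2 L) :
    ‖expMulEquiv L lam f‖ ≤ 2 / (1 + Real.exp (-lam * L)) * ‖f‖ := by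
  change ‖((2 / (1 + Real.exp (-lam * L)) : ℝ) : ℂ) • expMul L lam f‖ ≤ _
  rw [norm_smul, Complex.norm_real, Real.norm_of_nonneg (by positivity)]
  gcongr
  have h := norm_expMul_le lam f
  rwa [max_eq_left (exp_neg_lt_one hL hlam).le, one_mul] at h

theorem norm_expMulEquiv_symm_le {L lam : ℝ} (hL : 0 < L) (hlam : 0 < lam) (f : L2 L) :
    ‖(expMulEquiv L lam).symm f‖ ≤
      (2 / (1 + Real.exp (-lam * L)))⁻¹ * (Real.exp (lam * L) * ‖f‖) := by
  change ‖((2 / (1 + Real.exp (-lam * L)) : ℝ) : ℂ)⁻¹ • expMul L (-lam) f‖ ≤ _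
  rw [norm_smul, norm_inv, Complex.norm_real, Real.norm_of_nonneg (by positivity)]
  gcongr
  have h := norm_expMul_le (-lam) f
  rwa [neg_neg, max_eq_right (Real.one_le_exp (by positivity))] at h

/-- The factor `φ_n` cancels, so the feedback sees only the plain sum of the coefficients of `f`. -/
theorem feedback_pairing_term {L lam : ℝ} {φ : L2 L} {n : ℤ} (h : coef φ n ≠ 0) (z : ℂ) :
    conj (feedback lam φ n) * (coef φ n * z) = -(gain L lam : ℂ) * z := by
  rw [feedback, map_div₀, Complex.conj_conj, map_neg, Complex.conj_ofReal]
  field_simp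

/-- The backstepping transformation, with its properties: it is the required sum, it turns the
closed-loop operator into the target one, and it is bounded with bounded inverse. -/
theorem exists_backstepping {L lam c C : ℝ} (hL : 0 < L) (hlam : 0 < lam) {m : ℕ} {φ : L2 L}
    (hc : 0 < c) (hlow : ∀ n, c / Real.sqrt (weight L m n) ≤ ‖coef φ n‖)
    (hup : ∀ n, ‖coef φ n‖ ≤ C / Real.sqrt (weight L m n)) :
    ∃ T : HPer L m ≃L[ℂ] HPer L m, IsBackstepping lam (feedback lam φ) φ T ∧
      (∀ (μ : ℝ) (α g : HPer L m), ClosedLoopOp μ (feedback lam φ) φ α g ↔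
        ∀ n, (T g).coef n = -HPer.rate L (lam + μ) n * (T α).coef n) ∧
      ∃ A B : ℝ, (∀ α, ‖T α‖ ≤ A * ‖α‖) ∧ (∀ z, ‖T.symm z‖ ≤ B * ‖z‖) ∧ 0 ≤ B ∧
        B * A = (C / c) ^ 2 * Real.exp (lam * L) := by
  have hw : ∀ n, 0 < Real.sqrt (weight L m n) := fun n => Real.sqrt_pos.mpr (weight_pos L m n)
  have hφ : ∀ n, coef φ n ≠ 0 := fun n => norm_pos_iff.mp ((div_pos hc (hw n)).trans_le (hlow n))
  have hC : 0 ≤ C := by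
    have h := (div_le_div_iff_of_pos_right (hw 0)).mp ((hlow 0).trans (hup 0))
    exact hc.le.trans h
  obtain ⟨Φ, hΦ, hΦ1, hΦ2⟩ := HPer.exists_multiplierEquiv hL hc hlow hup
  set k : ℝ := 2 / (1 + Real.exp (-lam * L)) with hk
  have hk0 : 0 < k := by positivity
  have hkC : (k : ℂ) ≠ 0 := by exact_mod_cast hk0.ne'
  have hT : ∀ (α : HPer L m) (n : ℤ), ((Φ.trans (expMulEquiv L lam)).trans Φ.symm α).coef n =
      coef φ n * (k * coef (expMul L lam (Φ α)) n) := by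
    intro α n
    rw [hΦ, ContinuousLinearEquiv.trans_apply, ContinuousLinearEquiv.trans_apply,
      ContinuousLinearEquiv.apply_symm_apply, coef_expMulEquiv]
  -- The last two witnesses bound `T` and its inverse; `k` cancels in their product.
  refine ⟨(Φ.trans (expMulEquiv L lam)).trans Φ.symm, ?_, ?_, C * k * c⁻¹,
    C * (k⁻¹ * Real.exp (lam * L)) * c⁻¹, ?_, ?_, by positivity, ?_⟩
  · intro α p
    rw [hT]
    have h := ((hasSum_coef_expMul hL hlam.ne' (Φ α) p).mul_left (k : ℂ)).mul_left (coef φ p)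
    refine h.congr_fun fun n => ?_
    -- This identity dictates `k`: the gain is `k` times the constant in the matrix of `e^{-λx}`.
    have hg : (gain L lam : ℂ) = k * ((1 - Real.exp (-lam * L)) / L : ℝ) := by
      rw [← Complex.ofReal_mul, gain, hk]
      congr 1
      have := hL.ne'
      field_simp
    have hpair := feedback_pairing_term (lam := lam) (hφ n) (coef (Φ α) n)
    rw [hΦ, kernelCoef, neg_neg, neg_add_eq_sub]
    rw [hg] at hpair
    linear_combination (-(1 / ((lam : ℂ) + freq L (p - n))) * coef φ p) * hpair
  · intro μ α g
    have h1 : (∀ n, ((Φ.trans (expMulEquiv L lam)).trans Φ.symm g).coef n =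
        -HPer.rate L (lam + μ) n * ((Φ.trans (expMulEquiv L lam)).trans Φ.symm α).coef n) ↔
        ∀ n, coef (expMul L lam (Φ g)) n =
          -HPer.rate L (lam + μ) n * coef (expMul L lam (Φ α)) n := by
      -- The target operator is diagonal in Fourier modes, so the factors `φ_n` and `k` drop out
      -- mode by mode.
      refine forall_congr' fun n => ?_
      rw [hT, hT, mul_left_comm _ (coef φ n), mul_right_inj' (hφ n), mul_left_comm _ (k : ℂ),
        mul_right_inj' hkC]
    rw [h1, expMul_coef_eq_iff hL hlam]
    refine exists_congr fun u => and_congr ?_ (forall_congr' fun n => ?_)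
    · unfold HasPairing
      simp_rw [hΦ α, feedback_pairing_term (hφ _)]
    · rw [hΦ g, hΦ α]
      exact ⟨fun h => mul_left_cancel₀ (hφ n) (by linear_combination h),
        fun h => by linear_combination coef φ n * h⟩
  · intro α
    calc _ ≤ C * ‖expMulEquiv L lam (Φ α)‖ := hΦ2 _
      _ ≤ C * (k * (c⁻¹ * ‖α‖)) := by
        gcongr
        exact (norm_expMulEquiv_le hL hlam _).trans (by gcongr; exact hΦ1 α)
      _ = _ := by ring
  · intro z
    calc _ ≤ C * ‖(expMulEquiv L lam).symm (Φ z)‖ := hΦ2 _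
      _ ≤ C * (k⁻¹ * (Real.exp (lam * L) * (c⁻¹ * ‖z‖))) := by
        gcongr
        exact (norm_expMulEquiv_symm_le hL hlam _).trans (by gcongr; exact hΦ1 z)
      _ = _ := by ring
  · field_simp

end TransportStab

end

/-! ### Conjugation of the target semigroup and the decay estimate -/

theorem theorem1 (L : ℝ) (hL : 0 < L) (μ : ℝ) (m : ℕ) (hm : 1 ≤ m)
    (φ : TransportStab.L2 L)
    (hφpw : TransportStab.IsPiecewiseSobolev m L φ)
    (hφper : φ ∈ TransportStab.perSobolev L (m - 1))
    (c C : ℝ) (hc : 0 < c)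
    (hcopt : IsGreatest {a : ℝ | ∀ n : ℤ,
      a / Real.sqrt (TransportStab.weight L m n) ≤ ‖TransportStab.coef φ n‖} c)
    (hCopt : IsLeast {a : ℝ | ∀ n : ℤ,
      ‖TransportStab.coef φ n‖ ≤ a / Real.sqrt (TransportStab.weight L m n)} C)
    (lam : ℝ) (hlam : 0 < lam) :
    ∃ (S R : ℝ → TransportStab.HPer L m →L[ℂ] TransportStab.HPer L m)
      (T : TransportStab.HPer L m ≃L[ℂ] TransportStab.HPer L m),
      TransportStab.IsC0Semigroup S ∧
      (∀ α g : TransportStab.HPer L m, TransportStab.IsGenValue S α g ↔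
        TransportStab.ClosedLoopOp μ (TransportStab.feedback lam φ) φ α g) ∧
      TransportStab.IsC0Semigroup R ∧
      TransportStab.IsTransport hL (lam + μ) R ∧
      TransportStab.IsBackstepping lam (TransportStab.feedback lam φ) φ T ∧
      (∀ t : ℝ, 0 ≤ t → ∀ α : TransportStab.HPer L m, S t α = T.symm (R t (T α))) ∧
      ∀ α₀ : TransportStab.HPer L m,
        TransportStab.IsClosedLoopSolution μ (TransportStab.feedback lam φ) φ α₀
          (fun t => S t α₀) ∧
        (∀ t : ℝ, 0 ≤ t →
          ‖S t α₀‖ ≤ (C / c) ^ 2 * Real.exp (lam * L) * Real.exp (-(lam + μ) * t) * ‖α₀‖) ∧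
        (0 ≤ μ → ∀ t : ℝ, 0 ≤ t →
          ‖S t α₀‖ ≤ (C / c) ^ 2 * Real.exp ((μ + lam) * L) * Real.exp (-lam * t) * ‖α₀‖) := by
  obtain ⟨T, hT, hop, A, B, hA, hB, hB0, hAB⟩ :=
    TransportStab.exists_backstepping hL hlam hc hcopt.1 hCopt.1
  have hcomplete := TransportStab.HPer.completeSpace (s := m) hL
  let R : ℝ → TransportStab.HPer L m →L[ℂ] TransportStab.HPer L m :=
    fun t => TransportStab.HPer.transport hL (lam + μ) t
  have hR : TransportStab.IsC0Semigroup R :=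
    TransportStab.HPer.isC0Semigroup_transport hL (lam + μ)
  have hcont : ∀ x, Continuous fun t => R t x :=
    TransportStab.HPer.continuous_transport hL (lam + μ)
  have hScont : ∀ x, Continuous fun t => TransportStab.conjFamily T R t x :=
    fun x => T.symm.continuous.comp (hcont (T x))
  have hbound : ∀ (α₀ : TransportStab.HPer L m) (t : ℝ), ‖TransportStab.conjFamily T R t α₀‖ ≤
      (C / c) ^ 2 * Real.exp (lam * L) * Real.exp (-(lam + μ) * t) * ‖α₀‖ := fun α₀ t => by
    calc ‖T.symm (R t (T α₀))‖ ≤ B * ‖R t (T α₀)‖ := hB _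
      _ = B * (Real.exp (-(lam + μ) * t) * ‖T α₀‖) := by
        rw [TransportStab.HPer.norm_transport]
      _ ≤ B * (Real.exp (-(lam + μ) * t) * (A * ‖α₀‖)) := by gcongr; exact hA α₀
      _ = (B * A) * Real.exp (-(lam + μ) * t) * ‖α₀‖ := by ring
      _ = _ := by rw [hAB]
  refine ⟨TransportStab.conjFamily T R, R, T, hR.conjFamily T, fun α g => ?_, hR,
    TransportStab.HPer.isTransport_transport hL (lam + μ), hT, fun _ _ _ => rfl,
    fun α₀ => ⟨⟨(hScont α₀).continuousOn, ?_, fun t _ => ?_⟩, fun t _ => hbound α₀ t,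
      fun hμ t ht => (hbound α₀ t).trans ?_⟩⟩
  · rw [TransportStab.isGenValue_conjFamily_iff, hop]
    exact TransportStab.HPer.isGenValue_transport_iff hL (lam + μ) (T α) (T g)
  · rw [(hR.conjFamily T).zero, ContinuousLinearMap.id_apply]
  -- Since `T` is bounded it passes under the time integral, and the mild equation becomes the
  -- integrated target equation.
  · rw [hop]
    intro n
    have h1 : T (∫ r in (0 : ℝ)..t, TransportStab.conjFamily T R r α₀) =
        ∫ r in (0 : ℝ)..t, R r (T α₀) := by
      have h := ContinuousLinearMap.intervalIntegral_comp_comm (μ := volume)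
        (T : TransportStab.HPer L m →L[ℂ] TransportStab.HPer L m)
        ((hScont α₀).intervalIntegrable 0 t)
      refine h.symm.trans (intervalIntegral.integral_congr fun r _ => ?_)
      exact T.apply_symm_apply _
    rw [h1, map_sub, TransportStab.conjFamily_apply, T.apply_symm_apply]
    exact (TransportStab.HPer.rate_mul_coef_integral_transport hL (lam + μ) t (T α₀) n).symm
  -- For `μ ≥ 0` the second estimate only weakens the first: `e^{μL} ≥ 1` and `e^{-μt} ≤ 1`.
  · have h1 : Real.exp (lam * L) ≤ Real.exp ((μ + lam) * L) :=
      Real.exp_le_exp.mpr (by nlinarith)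
    have h2 : Real.exp (-(lam + μ) * t) ≤ Real.exp (-lam * t) :=
      Real.exp_le_exp.mpr (by nlinarith)
    gcongr
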